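/- Graphs are finite and undirected; they may have parallel edges (two parallel edges form a cycle of length $2$) but no self-loops. A set $X\subseteq V(G)$ is a $1$-fault tolerant feedback vertex set ($1$-fvs) of a graph $G$ if for every set $F\subseteq V(G)$ with $|F|\le 1$ the graph $G-(X\setminus F)$ is a forest. An instance $(G,S,k)$ of FT-FVS-Ext consists of a graph $G$ on $n$ vertices, a set $S\subseteq V(G)$ and an integer $k\ge 0$; a solution is a $1$-fvs $X$ of $G$ with $|X|\le k$ and $S\subseteq X$. Theorem. There is an algorithm that, given an instance $(G,S,k)$ of FT-FVS-Ext, computes in time $k^{O(k)}n^{O(1)}$ a solution of this instance or concludes correctly that no solution exists. Consequently, given $G$ and $k$, one can compute in time $k^{O(k)}n^{O(1)}$ a $1$-fvs of $G$ of size at most $k$ or conclude correctly that none exists; that is, FT-FVS is fixed-parameter tractable in the solution size $k$. Here an algorithm is a program of a random access machine with addition and subtraction and unit cost per instruction. The graph is given on the vertices $0,\dots,n-1$ by the matrix of the numbers of edges between its vertices. The time bound means at most $c\,k^{ck}(n+1)^c$ steps for a constant $c$ (with $0^0=1$). -/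

import Mathlib

/-! ## Multigraphs, forests and fault tolerant feedback vertex sets -/

namespace Graph

/-- `v` and `e` list, in cyclic order, the vertices and the edges of a cycle of length `l + 1`
of the multigraph `G`: the vertices are distinct, the edges are distinct, and the `i`-th edge
joins the `i`-th vertex to the next one (indices modulo `l + 1`). Two parallel edges form a cycle
of length `2`; a loop would form a cycle of length `1`. -/
def IsCycle {α β : Type*} (G : Graph α β) {l : ℕ} (v : Fin (l + 1) → α) (e : Fin (l + 1) → β) :
    Prop :=
  Function.Injective v ∧ Function.Injective e ∧ ∀ i, G.IsLink (e i) (v i) (v (i + 1))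

/-- A forest is a multigraph without cycles. -/
def IsForest {α β : Type*} (G : Graph α β) : Prop :=
  ∀ (l : ℕ) (v : Fin (l + 1) → α) (e : Fin (l + 1) → β), ¬ G.IsCycle v e

/-- A set `S` of vertices is a `d`-fault tolerant feedback vertex set (a `d`-fvs) of `G` if
`G - (S \ F)` is a forest for every set `F` of at most `d` vertices. -/
def IsFaultTolerantFVS {α β : Type*} (G : Graph α β) (d : ℕ) (S : Set α) : Prop :=
  S ⊆ G.vertexSet ∧
    ∀ F ⊆ G.vertexSet, F.encard ≤ d → (G.deleteVerts (S \ F)).IsForest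

/-- The number of edges of `G` with ends `x` and `y`. -/
noncomputable def multiplicity {α β : Type*} (G : Graph α β) (x y : α) : ℕ :=
  {e | G.IsLink e x y}.ncard

end Graph

/-- `X` is a solution of the instance `(G, S, k)` of FT-FVS-Ext. -/
def IsExtSolution {n : ℕ} {β : Type*} (G : Graph (Fin n) β) (S : Finset (Fin n)) (k : ℕ)
    (X : Finset (Fin n)) : Prop :=
  G.IsFaultTolerantFVS 1 (X : Set (Fin n)) ∧ X.card ≤ k ∧ S ⊆ X

/-- `X` is a solution of the instance `(G, k)` of FT-FVS. -/
def IsFTFVSSolution {n : ℕ} {β : Type*} (G : Graph (Fin n) β) (k : ℕ)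
    (X : Finset (Fin n)) : Prop :=
  G.IsFaultTolerantFVS 1 (X : Set (Fin n)) ∧ X.card ≤ k

/-! ## Random access machines

A program uses finitely many registers and an indirectly addressed memory, whose cells hold
natural numbers. Every instruction and every evaluation of a test takes one step. The only
arithmetic is addition and (truncated) subtraction, so that numbers grow by at most one bit per
step and the step count is polynomially related to the running time of Turing machines. -/

namespace RAM

/-- The contents of the registers and of the memory. -/
structure State where
  reg : ℕ → ℕ
  mem : ℕ → ℕ

/-- Programs. -/
inductive Prog where
  /-- Do nothing. -/
  | skip : Prog
  /-- `const r c`: put the constant `c` into register `r`. -/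
  | const (r c : ℕ) : Prog
  /-- `copy r a`: put the content of register `a` into register `r`. -/
  | copy (r a : ℕ) : Prog
  /-- `add r a b`: put the sum of registers `a` and `b` into register `r`. -/
  | add (r a b : ℕ) : Prog
  /-- `sub r a b`: put the truncated difference of registers `a` and `b` into register `r`. -/
  | sub (r a b : ℕ) : Prog
  /-- `load r a`: put into register `r` the memory cell whose address is in register `a`. -/
  | load (r a : ℕ) : Prog
  /-- `store a r`: put register `r` into the memory cell whose address is in register `a`. -/
  | store (a r : ℕ) : Prog
  /-- Run one program after another. -/
  | seq (p q : Prog) : Prog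
  /-- `ite r p q`: run `p` if register `r` is nonzero, and `q` otherwise. -/
  | ite (r : ℕ) (p q : Prog) : Prog
  /-- `while r p`: run `p` as long as register `r` is nonzero. -/
  | while (r : ℕ) (p : Prog) : Prog

/-- Put the value `x` into register `r`. -/
def State.setReg (s : State) (r x : ℕ) : State :=
  { s with reg := Function.update s.reg r x }

/-- Put the value `x` into the memory cell with address `a`. -/
def State.setMem (s : State) (a x : ℕ) : State :=
  { s with mem := Function.update s.mem a x }

/-- `Exec p s t s'`: started in state `s`, the program `p` halts after exactly `t` steps
in state `s'`. -/
inductive Exec : Prog → State → ℕ → State → Prop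
  | skip (s : State) : Exec Prog.skip s 1 s
  | const (r c : ℕ) (s : State) : Exec (Prog.const r c) s 1 (s.setReg r c)
  | copy (r a : ℕ) (s : State) : Exec (Prog.copy r a) s 1 (s.setReg r (s.reg a))
  | add (r a b : ℕ) (s : State) :
      Exec (Prog.add r a b) s 1 (s.setReg r (s.reg a + s.reg b))
  | sub (r a b : ℕ) (s : State) :
      Exec (Prog.sub r a b) s 1 (s.setReg r (s.reg a - s.reg b))
  | load (r a : ℕ) (s : State) :
      Exec (Prog.load r a) s 1 (s.setReg r (s.mem (s.reg a)))
  | store (a r : ℕ) (s : State) :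
      Exec (Prog.store a r) s 1 (s.setMem (s.reg a) (s.reg r))
  | seq {p q : Prog} {s₁ s₂ s₃ : State} {t₁ t₂ : ℕ} :
      Exec p s₁ t₁ s₂ → Exec q s₂ t₂ s₃ → Exec (Prog.seq p q) s₁ (t₁ + t₂) s₃
  | ite_true {r : ℕ} {p q : Prog} {s s' : State} {t : ℕ} :
      s.reg r ≠ 0 → Exec p s t s' → Exec (Prog.ite r p q) s (t + 1) s'
  | ite_false {r : ℕ} {p q : Prog} {s s' : State} {t : ℕ} :
      s.reg r = 0 → Exec q s t s' → Exec (Prog.ite r p q) s (t + 1) s'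
  | while_done {r : ℕ} {p : Prog} {s : State} :
      s.reg r = 0 → Exec (Prog.while r p) s 1 s
  | while_step {r : ℕ} {p : Prog} {s₁ s₂ s₃ : State} {t₁ t₂ : ℕ} :
      s₁.reg r ≠ 0 → Exec p s₁ t₁ s₂ → Exec (Prog.while r p) s₂ t₂ s₃ →
        Exec (Prog.while r p) s₁ (t₁ + t₂ + 1) s₃

/-- The vertex set written in the first `n` memory cells: the vertices whose cell holds `1`. -/
def State.output (s : State) (n : ℕ) : Finset (Fin n) :=
  Finset.univ.filter fun v => s.mem v = 1

/-- Started in state `s`, the program `p` halts within `T` steps; it either puts `1` into register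
`0` and writes some `X` with `IsSol X` into memory, or it puts `0` into register `0`
and there is no `X` with `IsSol X`. -/
def SolvesWithin (p : Prog) (s : State) (T : ℕ) {n : ℕ} (IsSol : Finset (Fin n) → Prop) : Prop :=
  ∃ (t : ℕ) (s' : State), Exec p s t s' ∧ t ≤ T ∧
    ((s'.reg 0 = 1 ∧ IsSol (s'.output n)) ∨ (s'.reg 0 = 0 ∧ ∀ X, ¬ IsSol X))

end RAM

/-! ## Encoding of the instances -/

/-- The input `(G, k)`: register `0` holds the number `n` of vertices, register `1` holds `k`, and
the first `n * n` memory cells hold the adjacency matrix of the multigraph `G` row by row (the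
number of edges between `u` and `v` is in cell `u * n + v`). Everything else is `0`. -/
noncomputable def ftfvsInput {n : ℕ} {β : Type*} (G : Graph (Fin n) β) (k : ℕ) : RAM.State where
  reg r := if r = 0 then n else if r = 1 then k else 0
  mem a := if h : a < n * n then G.multiplicity (Fin.divNat ⟨a, h⟩) (Fin.modNat ⟨a, h⟩) else 0

open Classical in
/-- The input `(G, S, k)`: as for `(G, k)`, followed by the characteristic vector of `S` in the
memory cells `n * n + u`. -/
noncomputable def extInput {n : ℕ} {β : Type*} (G : Graph (Fin n) β) (S : Finset (Fin n)) (k : ℕ) :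
    RAM.State where
  reg := (ftfvsInput G k).reg
  mem a := if ∃ u ∈ S, a = n * n + (u : ℕ) then 1 else (ftfvsInput G k).mem a

/-! A set $X$ is a 1-fvs exactly if every cycle contains at least two of its vertices: a cycle with
at most one would survive when that vertex is put into $F$. Cycles are replaced by cores, nonempty
vertex sets inducing minimum degree at least two. Every core contains a cycle and the vertices of a
cycle form a core, so the condition becomes `HitsTwice`, a statement about the matrix of
multiplicities alone (`isFaultTolerantFVS_one_iff`).

Two reductions preserve solvability. The ends of parallel edges lie in every solution
(`HitsTwice.mem_of_two_le`). An edge $vp$ outside $S$ can be contracted if $v$ has no other edge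
leaving $S$ untouched, or has total degree two. Indeed a core with fewer than two hits contains at
most one vertex of $S$, so it can pass through $v$ only along $vp$ (`HitsTwice.of_contract`);
conversely, a solution using $v$ can exchange it for another vertex (`HitsTwice.exists_contract`).

When no reduction applies and edges remain, the vertices with an edge in $G-S$ have degree at least
two there, so they form a core and the solution meets them. Let $x$ be a solution vertex of largest
degree in $G-S$. Removing the solution leaves a graph without cores, hence with few edges, and
counting degrees shows that fewer than $5k^2$ vertices precede $x$ in the order by degree
(`card_lt_of_resDeg_le`, `exists_mem_rank_lt`). So it suffices to branch over $O(k^2)$ vertices, at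
most $k$ times.

The branching is made deterministic by a choice code, a number whose digits to base `branching k`
are the choices. Each effective step lowers the number of nonisolated vertices outside $S$, so $n$
steps suffice for each code, and $(5k^2+1)^k$ codes are tried (`exists_code`, `refines_iterate`).
The program is written in a language whose loops are bounded by constant registers. Compilation
gives a running time polynomial in those registers, the largest of which is the number of codes. -/

open Finset in
theorem Finset.sum_sum_insert_of_symm {α : Type*} [DecidableEq α] {M : α → α → ℕ}
    (hs : ∀ u v, M u v = M v u) (hd : ∀ u, M u u = 0) {A : Finset α} {v : α} (hv : v ∉ A) :
    ∑ x ∈ insert v A, ∑ y ∈ insert v A, M x y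
      = 2 * ∑ y ∈ A, M v y + ∑ x ∈ A, ∑ y ∈ A, M x y := by
  rw [sum_insert hv, sum_insert hv, hd]
  have : ∀ x ∈ A, ∑ y ∈ insert v A, M x y = M v x + ∑ y ∈ A, M x y := fun x _ => by
    rw [sum_insert hv, hs x v]
  rw [sum_congr rfl this, sum_add_distrib]
  omega

/-! ## Multigraphs given by their matrix of edge multiplicities -/

namespace MultMatrix

open Finset

variable {α : Type*}

/-- A symmetric matrix with zero diagonal. -/
structure IsLoopless (M : α → α → ℕ) : Prop where
  symm : ∀ u v, M u v = M v u
  diag : ∀ u, M u u = 0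

/-- `B` is nonempty and induces a subgraph of minimum degree at least two. -/
def IsCore (M : α → α → ℕ) (B : Finset α) : Prop :=
  B.Nonempty ∧ ∀ v ∈ B, 2 ≤ ∑ w ∈ B, M v w

/-- Every core contains two elements of `X`; see `isFaultTolerantFVS_one_iff`. -/
def HitsTwice [DecidableEq α] (M : α → α → ℕ) (X : Finset α) : Prop :=
  ∀ B, IsCore M B → 2 ≤ #(B ∩ X)

/-- The matrix after moving all edges at `v` other than those to `p` to `p`. -/
def contract [DecidableEq α] (M : α → α → ℕ) (v p : α) : α → α → ℕ := fun u w =>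
  if u = v ∨ w = v ∨ u = w then 0 else
    if u = p then M u w + M v w else if w = p then M u w + M u v else M u w

variable [DecidableEq α] {M : α → α → ℕ}

theorem IsLoopless.contract (hM : IsLoopless M) (v p : α) : IsLoopless (contract M v p) := by
  have := hM.symm
  constructor
  · intro u w
    unfold MultMatrix.contract
    grind
  · intro u
    simp [MultMatrix.contract]

/-- A multigraph without cores has at most as many edges as vertices. -/
theorem sum_sum_le_of_forall_not_isCore (hM : IsLoopless M) (A : Finset α)
    (hA : ∀ B ⊆ A, ¬ IsCore M B) : ∑ x ∈ A, ∑ y ∈ A, M x y ≤ 2 * #A := by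
  induction hn : #A generalizing A with
  | zero => simp [card_eq_zero.1 hn]
  | succ m ih =>
    have hne : A.Nonempty := card_pos.1 (by omega)
    -- `A` itself is not a core, so a vertex of degree at most one can be removed; this lowers the
    -- double sum by at most two.
    have h : ∃ v ∈ A, ∑ w ∈ A, M v w ≤ 1 := by
      by_contra! h
      exact hA A Subset.rfl ⟨hne, fun v hv => h v hv⟩
    obtain ⟨v, hv, h⟩ := h
    have h1 := ih (A.erase v) (fun B hB => hA B (hB.trans (erase_subset _ _)))
      (by rw [card_erase_of_mem hv]; omega)
    rw [← insert_erase hv, sum_sum_insert_of_symm hM.symm hM.diag (notMem_erase v A)]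
    have h2 : ∑ y ∈ A.erase v, M v y ≤ ∑ y ∈ A, M v y :=
      sum_le_sum_of_subset (erase_subset _ _)
    omega

/-! ### Cores under contraction of an edge -/

/-- The vertex `p` inherits the edges of `v` into `B`, except those between `v` and `p`, which would
become loops and are dropped. -/
theorem sum_contract_of_mem (hM : IsLoopless M) {v p : α} (hvp : v ≠ p) {B : Finset α}
    (hv : v ∉ B) (hp : p ∈ B) :
    ∑ w ∈ B, contract M v p p w + M v p = ∑ w ∈ B, M p w + ∑ w ∈ B, M v w := by
  rw [← sum_add_distrib, ← add_sum_erase _ _ hp, ← add_sum_erase (a := p) _ _ hp, hM.diag]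
  have : ∀ w ∈ B.erase p, contract M v p p w = M p w + M v w := by
    intro w hw
    have := ne_of_mem_erase hw
    have : w ≠ v := fun h => hv (h ▸ mem_of_mem_erase hw)
    unfold contract
    grind
  rw [sum_congr rfl this]
  simp [contract]
  omega

theorem sum_contract_of_ne (hM : IsLoopless M) {v p u : α} {B : Finset α}
    (hv : v ∉ B) (hp : p ∈ B) (huv : u ≠ v) (hup : u ≠ p) :
    ∑ w ∈ B, contract M v p u w = ∑ w ∈ B, M u w + M u v := by
  rw [← add_sum_erase _ _ hp, ← add_sum_erase (a := p) _ _ hp]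
  have : ∀ w ∈ B.erase p, contract M v p u w = M u w := by
    intro w hw
    have := ne_of_mem_erase hw
    have : w ≠ v := fun h => hv (h ▸ mem_of_mem_erase hw)
    have := hM.diag u
    unfold contract
    grind
  rw [sum_congr rfl this]
  have : contract M v p u p = M u p + M u v := by
    by_cases h : p = v
    · exact absurd (h ▸ hp) hv
    · unfold contract; grind
  have e : (B.erase p).sum (M u) = ∑ x ∈ B.erase p, M u x := rfl
  omega

theorem contract_of_notMem (hM : IsLoopless M) {v p : α} {B : Finset α}
    (hv : v ∉ B) (hp : p ∉ B) {u w : α} (hu : u ∈ B) (hw : w ∈ B) :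
    contract M v p u w = M u w := by
  have := hM.diag u
  unfold contract
  grind

/-- Between vertices other than `v`, contraction never lowers a multiplicity. -/
theorem IsCore.contract (hM : IsLoopless M) {v p : α} {B : Finset α} (hB : IsCore M B)
    (hv : v ∉ B) : IsCore (contract M v p) B := by
  refine ⟨hB.1, fun u hu => (hB.2 u hu).trans (sum_le_sum fun w hw => ?_)⟩
  have := hM.diag u
  unfold MultMatrix.contract
  grind

/-- The merged vertex has degree at least $2+2-2$, because the single edge `v p` is lost at both
ends; the other degrees do not change. -/
theorem IsCore.contract_erase (hM : IsLoopless M) {v p : α} {B : Finset α} (hB : IsCore M B)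
    (hv : v ∈ B) (hp : p ∈ B) (hvp : M v p = 1) : IsCore (MultMatrix.contract M v p) (B.erase v) := by
  have hne : v ≠ p := by rintro rfl; simp [hM.diag] at hvp
  have hp' : p ∈ B.erase v := mem_erase.2 ⟨hne.symm, hp⟩
  refine ⟨⟨p, hp'⟩, fun u hu => ?_⟩
  have huv := ne_of_mem_erase hu
  have h1 := hB.2 u (mem_of_mem_erase hu)
  rw [← add_sum_erase _ _ hv] at h1
  by_cases hup : u = p
  · subst hup
    have h2 := sum_contract_of_mem hM hne (notMem_erase v B) hp'
    have h3 := hB.2 v hv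
    rw [← add_sum_erase _ _ hv, hM.diag] at h3
    rw [hM.symm u v] at h1
    omega
  · rw [sum_contract_of_ne hM (notMem_erase v B) hp' huv hup]
    omega

theorem notMem_of_isCore_contract {v p : α} {B : Finset α}
    (hB : IsCore (contract M v p) B) : v ∉ B := by
  intro hv
  have := hB.2 v hv
  simp [contract] at this

/-- Undoing the contraction: one of the two edges of `v` into `B` goes to `p` and replaces the edge
that `p` had inherited, so all degrees in `B` are kept and `v` has degree two. -/
theorem isCore_insert_of_contract (hM : IsLoopless M) {v p : α} {B : Finset α}
    (hvp : M v p = 1) (hB : IsCore (contract M v p) B) (hp : p ∈ B)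
    (h2 : ∑ w ∈ B, M v w = 2) : IsCore M (insert v B) := by
  have hne : v ≠ p := by rintro rfl; simp [hM.diag] at hvp
  have hv := notMem_of_isCore_contract hB
  refine ⟨⟨v, mem_insert_self _ _⟩, fun u hu => ?_⟩
  rw [sum_insert hv]
  rcases mem_insert.1 hu with rfl | hu
  · omega
  have h := hB.2 u hu
  by_cases hup : u = p
  · subst hup
    have := sum_contract_of_mem hM hne hv hu
    have := hM.symm v u
    omega
  · rw [sum_contract_of_ne hM hv hp (fun h => hv (h ▸ hu)) hup] at h
    omega

/-- No moved edge lies inside `B`: either `p` is not in `B`, or `v p` is the only edge from `v` into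
`B`. So the two matrices agree on `B`. -/
theorem isCore_of_contract (hM : IsLoopless M) {v p : α} {B : Finset α}
    (hvp : M v p = 1) (hB : IsCore (contract M v p) B)
    (h2 : p ∈ B → ∑ w ∈ B, M v w ≤ 1) : IsCore M B := by
  have hv := notMem_of_isCore_contract hB
  have hne : v ≠ p := by rintro rfl; simp [hM.diag] at hvp
  refine ⟨hB.1, fun u hu => (hB.2 u hu).trans ?_⟩
  by_cases hp : p ∈ B
  · specialize h2 hp
    rw [← add_sum_erase _ _ hp, hvp] at h2
    have h0 : ∀ w ∈ B.erase p, M v w = 0 := by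
      rw [← Finset.sum_eq_zero_iff]; omega
    by_cases hup : u = p
    · subst hup
      have h3 := sum_contract_of_mem hM hne hv hu
      rw [← add_sum_erase _ (M v) hu, sum_eq_zero h0] at h3
      omega
    · rw [sum_contract_of_ne hM hv hp (fun h => hv (h ▸ hu)) hup, hM.symm u v,
        h0 u (mem_erase.2 ⟨hup, hu⟩)]
      simp
  · exact (sum_congr rfl fun w hw => contract_of_notMem hM hv hp hu hw).le

/-- Two vertices joined by parallel edges form a core of size two, and both must be hit. -/
theorem HitsTwice.mem_of_two_le (hM : IsLoopless M) {X : Finset α} {u v : α} (h : 2 ≤ M u v)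
    (hX : HitsTwice M X) : u ∈ X := by
  have hne : u ≠ v := by rintro rfl; simp [hM.diag] at h
  have hB : IsCore M {u, v} := by
    refine ⟨⟨u, by simp⟩, fun x hx => ?_⟩
    rw [sum_pair hne]
    have := hM.symm u v
    rcases mem_insert.1 hx with rfl | hx
    · omega
    · rw [mem_singleton] at hx; subst hx; omega
  by_contra hu
  have h1 := hX _ hB
  rw [insert_inter_of_notMem hu] at h1
  have := card_le_card (inter_subset_left (s₁ := {v}) (s₂ := X))
  simp at this
  omega

variable [Fintype α]

/-- The number of edges from `u` to vertices outside `S`. -/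
def outDeg (M : α → α → ℕ) (S : Finset α) (u : α) : ℕ := ∑ w ∈ Sᶜ, M u w

/-- The edge from `u` to `v` can be contracted. -/
def Contractible (M : α → α → ℕ) (S : Finset α) (u v : α) : Prop :=
  u ∉ S ∧ v ∉ S ∧ M u v ≠ 0 ∧ (outDeg M S u = 1 ∨ ∑ w, M u w = 2)

/-- Used for cores that meet `S` at most once: there the simple edges of `v` to `S` contribute at
most one to its degree. -/
theorem sum_le_outDeg_add (M : α → α → ℕ) {S B : Finset α} {v : α} (h1 : ∀ w, M v w ≤ 1) :
    ∑ w ∈ B, M v w ≤ outDeg M S v + #(B ∩ S) := by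
  rw [← sum_inter_add_sum_sdiff B S, add_comm]
  gcongr
  · exact sum_le_sum_of_subset fun w hw => by simp at hw ⊢; exact hw.2
  · simpa using sum_le_sum fun w (_ : w ∈ B ∩ S) => h1 w

/-- A core through `v` with fewer than two hits has at most one vertex in `S`, so `v` reaches degree
two only by using `p`. Erasing `v` then leaves a core of the contracted graph, which is hit twice.
-/
theorem HitsTwice.of_contract (hM : IsLoopless M) {S X : Finset α} {v p : α}
    (h1 : ∀ w, M v w ≤ 1) (hc : Contractible M S v p) (hSX : S ⊆ X)
    (hX : HitsTwice (contract M v p) X) : HitsTwice M X := by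
  obtain ⟨hv, hp, hne, hc⟩ := hc
  have hvp : M v p = 1 := le_antisymm (h1 p) (Nat.one_le_iff_ne_zero.2 hne)
  intro B hB
  by_cases hvB : v ∈ B
  · by_contra! hlt
    have hS : #(B ∩ S) ≤ 1 :=
      (card_le_card (inter_subset_inter_left hSX)).trans (Nat.lt_succ_iff.1 hlt)
    have hdeg := hB.2 v hvB
    have hpB : p ∈ B := by
      by_contra hpB
      rcases hc with hc | hc
      -- Counting `p` as a vertex of `S` removes the only outgoing edge of `v`, and `p` is not in
      -- `B`; so `v` would have degree at most one in `B`.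
      · have h3 := sum_le_outDeg_add M (S := insert p S) (B := B) h1
        have h4 : outDeg M S v = M v p + outDeg M (insert p S) v := by
          unfold outDeg
          rw [← add_sum_erase _ _ (mem_compl.2 hp)]
          congr 2
          ext; simp
        rw [inter_insert_of_notMem hpB] at h3
        omega
      · have h3 : M v p + ∑ w ∈ B, M v w ≤ ∑ w, M v w := by
          rw [← sum_insert hpB]
          exact sum_le_sum_of_subset (subset_univ _)
        omega
    have := hX _ (hB.contract_erase hM hvB hpB hvp)
    have := card_le_card (inter_subset_inter_right (u := X) (erase_subset v B))
    omega
  · exact hX B (hB.contract hM hvB)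

/-- Contraction isolates `v`, so a solution containing `v` must exchange it. The only cores of the
contracted graph that might not be cores before are those containing `p` into which `v` sends two
edges; adding `v` turns these into cores. The replacement vertex is chosen to hit them. -/
theorem HitsTwice.exists_contract (hM : IsLoopless M) {S X : Finset α} {v p : α}
    (h1 : ∀ w, M v w ≤ 1) (hc : Contractible M S v p) (hSX : S ⊆ X) (hX : HitsTwice M X) :
    ∃ X', S ⊆ X' ∧ #X' ≤ #X ∧ HitsTwice (contract M v p) X' := by
  obtain ⟨hv, hp, hne, hc⟩ := hc
  have hvp : M v p = 1 := le_antisymm (h1 p) (Nat.one_le_iff_ne_zero.2 hne)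
  -- it suffices to exchange `v` for a suitable `b` so that the cores through the edge are hit
  suffices h : ∃ X', S ⊆ X' ∧ #X' ≤ #X ∧ X.erase v ⊆ X' ∧ ∀ B, IsCore (contract M v p) B →
      p ∈ B → ∑ w ∈ B, M v w = 2 → 2 ≤ #(insert v B ∩ X) → 2 ≤ #(B ∩ X') by
    obtain ⟨X', hS, hcard, hsub, h⟩ := h
    refine ⟨X', hS, hcard, fun B hB => ?_⟩
    by_contra! hlt
    have hvB := notMem_of_isCore_contract hB
    have hle : #(B ∩ X) ≤ #(B ∩ X') := card_le_card fun x hx => by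
      rw [mem_inter] at hx ⊢
      exact ⟨hx.1, hsub (mem_erase.2 ⟨fun h => hvB (h ▸ hx.1), hx.2⟩)⟩
    have hB' : IsCore M B → False := fun hB' => by have := hX B hB'; omega
    have hS1 : #(B ∩ S) ≤ 1 :=
      (card_le_card (inter_subset_inter_left hS)).trans (Nat.lt_succ_iff.1 hlt)
    by_cases hlow : p ∈ B → ∑ w ∈ B, M v w ≤ 1
    · exact hB' (isCore_of_contract hM hvp hB hlow)
    · push Not at hlow
      have h2 : ∑ w ∈ B, M v w ≤ 2 := by
        rcases hc with hc | hc
        · have := sum_le_outDeg_add M (S := S) (B := B) h1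
          omega
        · exact hc ▸ sum_le_sum_of_subset (subset_univ _)
      have h2 : ∑ w ∈ B, M v w = 2 := by omega
      have := h B hB hlow.1 h2 (hX _ (isCore_insert_of_contract hM hvp hB hlow.1 h2))
      omega
  by_cases hvX : v ∈ X
  swap
  · refine ⟨X, hSX, le_rfl, erase_subset _ _, fun B _ _ _ h => ?_⟩
    rwa [insert_inter_of_notMem hvX] at h
  have hSe : ∀ b, S ⊆ insert b (X.erase v) := fun b s hs =>
    mem_insert_of_mem (mem_erase.2 ⟨fun h => hv (h ▸ hs), hSX hs⟩)
  have hce : ∀ b, #(insert b (X.erase v)) ≤ #X := fun b =>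
    (card_insert_le _ _).trans (card_erase_add_one hvX).le
  have hpair : ∀ {B Y : Finset α} {a b : α}, a ≠ b → a ∈ B → b ∈ B → a ∈ Y → b ∈ Y →
      2 ≤ #(B ∩ Y) := fun hab ha hb ha' hb' =>
    one_lt_card.2 ⟨_, mem_inter.2 ⟨ha, ha'⟩, _, mem_inter.2 ⟨hb, hb'⟩, hab⟩
  rcases hc with hc | hc
  -- With a single edge leaving to the outside of `S`, the second edge of `v` into `B` ends in some
  -- `s ∈ S`; now `p` and `s` are the two hits.
  · refine ⟨insert p (X.erase v), hSe p, hce p, subset_insert _ _, fun B hB hpB h2 _ => ?_⟩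
    have h3 := sum_le_outDeg_add M (S := S) (B := B) h1
    obtain ⟨s, hs⟩ : (B ∩ S).Nonempty := card_pos.1 (by omega)
    rw [mem_inter] at hs
    exact hpair (by rintro rfl; exact hp hs.2) hpB hs.1 (mem_insert_self _ _) (hSe p hs.2)
  -- Here `v` has total degree two. If `p` is already taken, the other neighbour `b` is used, and
  -- both neighbours lie in `B`. If not, `p` replaces `v`, and the second hit of `insert v B`
  -- remains.
  · by_cases hpX : p ∈ X
    · have h3 : ∃ b ∈ univ.erase p, M v b ≠ 0 := by
        by_contra! h
        rw [← add_sum_erase _ _ (mem_univ p), hvp, sum_eq_zero h] at hc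
        omega
      obtain ⟨b, hb, hb0⟩ := h3
      refine ⟨insert b (X.erase v), hSe b, hce b, subset_insert _ _, fun B hB hpB h2 _ => ?_⟩
      have hbB : b ∈ B := by
        by_contra hbB
        have : M v b + ∑ w ∈ B, M v w ≤ ∑ w, M v w := by
          rw [← sum_insert hbB]
          exact sum_le_sum_of_subset (subset_univ _)
        omega
      refine hpair (ne_of_mem_erase hb).symm hpB hbB (mem_insert_of_mem (mem_erase.2 ⟨?_, hpX⟩))
        (mem_insert_self _ _)
      rintro rfl
      simp [hM.diag] at hvp
    · refine ⟨insert p (X.erase v), hSe p, hce p, subset_insert _ _, fun B hB hpB h2 h => ?_⟩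
      have hvB := notMem_of_isCore_contract hB
      rw [insert_inter_of_mem hvX, card_insert_of_notMem (by simp [hvB])] at h
      obtain ⟨x, hx⟩ : (B ∩ X).Nonempty := card_pos.1 (by omega)
      rw [mem_inter] at hx
      exact hpair (by rintro rfl; exact hpX hx.2) hpB hx.1 (mem_insert_self _ _)
        (mem_insert_of_mem (mem_erase.2 ⟨fun h => hvB (h ▸ hx.1), hx.2⟩))

/-- Outside `S` there are no edges left, and only simple edges join the rest to `S`. -/
def IsDone (M : α → α → ℕ) (S : Finset α) : Prop :=
  ∀ u v, ¬ (u ∉ S ∧ (2 ≤ M u v ∨ (v ∉ S ∧ M u v ≠ 0)))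

/-- A vertex of a core outside `S` has only simple edges, all to `S`, and needs two of them. A core
inside `S` has at least two vertices since there are no loops. -/
theorem IsDone.hitsTwice (hM : IsLoopless M) {S : Finset α} (h : IsDone M S) :
    HitsTwice M S := by
  intro B hB
  by_contra! hlt
  have h1 : ∀ u ∉ S, ∀ v, M u v ≤ 1 := fun u hu v => by
    by_contra! h2
    exact h u v ⟨hu, Or.inl h2⟩
  have h0 : ∀ u ∉ S, outDeg M S u = 0 := fun u hu => sum_eq_zero fun v hv => by
    by_contra h2
    exact h u v ⟨hu, Or.inr ⟨mem_compl.1 hv, h2⟩⟩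
  by_cases hsub : B ⊆ S
  · rw [inter_eq_left.2 hsub] at hlt
    obtain ⟨u, hu⟩ := hB.1
    have h2 := hB.2 u hu
    have : B = {u} := (eq_singleton_iff_unique_mem).2
      ⟨hu, fun x hx => card_le_one.1 (by omega) x hx u hu⟩
    rw [this, sum_singleton, hM.diag] at h2
    omega
  · obtain ⟨u, hu, hS⟩ := not_subset.1 hsub
    have := hB.2 u hu
    have := sum_le_outDeg_add M (S := S) (B := B) (h1 u hS)
    have := h0 u hS
    omega

end MultMatrix

/-! ### Branching on vertices of large residual degree -/

namespace MultMatrix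

open Finset

/-- The number of `w` that are larger than `u` in the order by `f` with ties broken by `<`. -/
def rank {α : Type*} [Fintype α] [LinearOrder α] (f : α → ℕ) (u : α) : ℕ :=
  #{w | f u < f w ∨ (f u = f w ∧ u < w)}

theorem rank_lt_rank {α : Type*} [Fintype α] [LinearOrder α] {f : α → ℕ} {u v : α}
    (h : f u < f v ∨ (f u = f v ∧ u < v)) : rank f v < rank f u := by
  refine card_lt_card (ssubset_iff_of_subset (fun w hw => ?_) |>.2 ⟨v, by simpa using h, by simp⟩)
  simp only [mem_filter, mem_univ, true_and] at hw ⊢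
  rcases h with h | h <;> rcases hw with hw | hw
  · omega
  · omega
  · omega
  · exact Or.inr ⟨h.1.trans hw.1, h.2.trans hw.2⟩

theorem rank_injective {α : Type*} [Fintype α] [LinearOrder α] (f : α → ℕ) :
    Function.Injective (rank f) := by
  intro u v h
  by_contra hne
  have : (f u < f v ∨ (f u = f v ∧ u < v)) ∨ (f v < f u ∨ (f v = f u ∧ v < u)) := by
    rcases lt_trichotomy (f u) (f v) with h1 | h1 | h1
    · exact Or.inl (Or.inl h1)
    · rcases lt_or_gt_of_ne hne with h2 | h2
      · exact Or.inl (Or.inr ⟨h1, h2⟩)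
      · exact Or.inr (Or.inr ⟨h1.symm, h2⟩)
    · exact Or.inr (Or.inl h1)
  rcases this with h1 | h1 <;> have := rank_lt_rank h1 <;> omega

/-- The degree in the graph without `S`. -/
def resDeg {α : Type*} [Fintype α] [DecidableEq α] (M : α → α → ℕ) (S : Finset α) (u : α) : ℕ :=
  if u ∈ S then 0 else outDeg M S u

section Branching

variable {α : Type*} [Fintype α] [DecidableEq α] {M : α → α → ℕ} {S X : Finset α}

/-- By symmetry a neighbour outside `S` of a vertex outside `S` has positive residual degree itself.
So the vertices of positive residual degree carry all edges outside `S`. -/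
theorem resDeg_eq_sum (hM : IsLoopless M) {u : α} (hu : u ∉ S) :
    resDeg M S u = ∑ w ∈ univ.filter (0 < resDeg M S ·), M u w := by
  rw [resDeg, if_neg hu, outDeg]
  refine (sum_subset (fun w hw => ?_) fun w hw hw' => ?_).symm
  · rw [mem_compl]
    intro h
    have := (mem_filter.1 hw).2
    simp [resDeg, h] at this
  · by_contra h0
    have hwS := mem_compl.1 hw
    refine hw' (mem_filter.2 ⟨mem_univ _, ?_⟩)
    rw [resDeg, if_neg hwS, outDeg]
    exact lt_of_lt_of_le (Nat.pos_of_ne_zero (hM.symm u w ▸ h0))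
      (single_le_sum (f := fun x => M w x) (fun _ _ => Nat.zero_le _) (mem_compl.2 hu))

/-- In a reduced instance a solution cannot avoid a set `T` of many vertices whose degrees are at
least those of the vertices of the solution. -/
theorem card_lt_of_resDeg_le (hM : IsLoopless M) {k δ : ℕ} (hX : HitsTwice M X) (hSX : S ⊆ X)
    (hk : #X ≤ k) (hc : ∀ u v, ¬ Contractible M S u v)
    (hδ : ∀ x ∈ X, resDeg M S x ≤ δ) (h2δ : 2 ≤ δ) (hk0 : 0 < k) {T : Finset α}
    (hT : ∀ x ∈ T, δ ≤ resDeg M S x) (hTX : Disjoint T X) : #T < 5 * (k * k) := by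
  set D := resDeg M S with hD
  set V := univ.filter (0 < D ·) with hV
  have hVS : ∀ u ∈ V, u ∉ S := fun u hu hS => by simp [hV, hD, resDeg, hS] at hu
  have hsum : ∀ u ∈ V, D u = ∑ w ∈ V, M u w := fun u hu => resDeg_eq_sum hM (hVS u hu)
  have hne : ∀ u ∈ V, ∃ w ∈ V, M u w ≠ 0 := fun u hu => by
    by_contra! h
    have h3 := hsum u hu
    rw [sum_eq_zero h] at h3
    simp [hV, h3] at hu
  have hnc : ∀ u ∈ V, D u ≠ 1 ∧ ∑ w, M u w ≠ 2 := fun u hu => by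
    obtain ⟨w, hw, h⟩ := hne u hu
    have h3 : D u = outDeg M S u := if_neg (hVS u hu)
    constructor <;> intro h4 <;> refine hc u w ⟨hVS u hu, hVS w hw, h, ?_⟩
    · exact Or.inl (h3 ▸ h4)
    · exact Or.inr h4
  have hV2 : ∀ u ∈ V, 2 ≤ D u := fun u hu => by
    have := (hnc u hu).1
    have : 0 < D u := (mem_filter.1 hu).2
    omega
  set A := V \ X with hA
  set Y := V ∩ X with hY
  have hYk : #Y ≤ k := (card_le_card inter_subset_right).trans hk
  have hcard : #A + #Y = #V := by rw [hA, hY]; exact card_sdiff_add_card_inter V X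
  have hsumY : ∑ x ∈ Y, D x ≤ #Y * δ := by
    simpa using sum_le_card_nsmul Y D δ fun x hx => hδ x (mem_inter.1 hx).2
  -- Edges inside `A` are counted by the double sum; each other edge has an end in `Y` and
  -- contributes two to the left side.
  have hlow : ∑ u ∈ V, D u ≤ ∑ x ∈ A, ∑ y ∈ A, M x y + 2 * ∑ x ∈ Y, D x := by
    have e1 : ∀ f : α → ℕ, ∑ u ∈ V, f u = ∑ u ∈ Y, f u + ∑ u ∈ A, f u := fun f =>
      (sum_inter_add_sum_sdiff V X f).symm
    have e2 : ∑ u ∈ A, D u = ∑ u ∈ A, ∑ y ∈ Y, M u y + ∑ x ∈ A, ∑ y ∈ A, M x y := by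
      rw [← sum_add_distrib]
      exact sum_congr rfl fun u hu => (hsum u (mem_sdiff.1 hu).1).trans (e1 _)
    have e3 : ∑ u ∈ A, ∑ y ∈ Y, M u y ≤ ∑ x ∈ Y, D x := by
      rw [sum_comm]
      refine sum_le_sum fun y hy => ?_
      rw [hsum y (mem_inter.1 hy).1, sum_congr rfl fun u _ => hM.symm u y]
      exact sum_le_sum_of_subset sdiff_subset
    rw [e1, e2]
    omega
  have hAA : ∑ x ∈ A, ∑ y ∈ A, M x y ≤ 2 * #A :=
    sum_sum_le_of_forall_not_isCore hM A fun B hB hcore => by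
      have := hX B hcore
      rw [disjoint_iff_inter_eq_empty.1 (disjoint_sdiff_self_left.mono_left hB)] at this
      simp at this
  -- Together with `hlow` and `hAA` this bounds the total excess over degree two by
  -- $2\sum_{Y}D-2|Y|$, which is at most $2|Y|(\delta-1)$.
  have hexc : ∑ u ∈ V, (D u - 2) + 2 * #V = ∑ u ∈ V, D u := by
    rw [mul_comm, ← smul_eq_mul, ← sum_const, ← sum_add_distrib]
    exact sum_congr rfl fun u hu => by have := hV2 u hu; omega
  have hTV : T ⊆ V := fun u hu => mem_filter.2 ⟨mem_univ _, by have := hT u hu; omega⟩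
  have hYδ : #Y * δ ≤ k * δ := Nat.mul_le_mul_right _ hYk
  have hkk : k ≤ k * k := Nat.le_mul_of_pos_left k hk0
  -- For `δ ≥ 3` every vertex of `T` has excess at least `δ - 2`, and the excess bound suffices. For
  -- `δ = 2` the excess may vanish, and edges to `S` have to be counted as well.
  rcases h2δ.lt_or_eq with h3 | rfl
  · have h4 : #T * (δ - 2) ≤ ∑ u ∈ V, (D u - 2) := by
      refine le_trans ?_ (sum_le_sum_of_subset hTV)
      simpa using card_nsmul_le_sum T (fun u => D u - 2) (δ - 2) fun x hx =>
        Nat.sub_le_sub_right (hT x hx) 2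
    obtain ⟨e, rfl⟩ : ∃ e, δ = e + 3 := ⟨δ - 3, by omega⟩
    have h5 : e + 3 - 2 = e + 1 := by omega
    rw [h5] at h4
    by_contra! h6
    have h7 : 5 * (k * k) * (e + 1) ≤ #T * (e + 1) := Nat.mul_le_mul_right _ h6
    have h9 : k * (e + 1) ≤ k * k * (e + 1) := Nat.mul_le_mul_right _ hkk
    have h10 : #Y * (e + 3) = #Y * (e + 1) + 2 * #Y := by ring
    have h11 : #Y * (e + 1) ≤ k * (e + 1) := Nat.mul_le_mul_right _ hYk
    have h12 : k ≤ k * (e + 1) := Nat.le_mul_of_pos_right k (by omega)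
    have h13 : 5 * (k * k) * (e + 1) = 5 * (k * k * (e + 1)) := by ring
    omega
  -- A core inside `insert s A` would be hit only by `s`, so there is none and this set spans at
  -- most $|A|+1$ edges. Since the excess bound also forces at least $|A|-|Y|$ edges inside `A`, at
  -- most $1+|Y|$ remain for `s`.
  · have hatt : ∀ s ∈ S, ∑ u ∈ A, M s u ≤ 1 + k := fun s hs => by
      have hsA : s ∉ A := fun h => hVS s (mem_sdiff.1 h).1 hs
      have h4 := sum_sum_le_of_forall_not_isCore hM (insert s A) fun B hB hcore => by
        have h5 := hX B hcore
        have h6 : B ∩ X ⊆ {s} := fun x hx => by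
          have := mem_inter.1 hx
          rcases mem_insert.1 (hB this.1) with h | h
          · simp [h]
          · exact absurd this.2 (mem_sdiff.1 h).2
        have := card_le_card h6
        simp at this
        omega
      rw [sum_sum_insert_of_symm hM.symm hM.diag hsA, card_insert_of_notMem hsA] at h4
      omega
    have hTA : T ⊆ A := fun u hu => mem_sdiff.2 ⟨hTV hu, disjoint_left.1 hTX hu⟩
    have h4 : #T ≤ ∑ u ∈ A, ((D u - 2) + ∑ s ∈ S, M s u) := by
      refine le_trans ?_ (sum_le_sum_of_subset hTA)
      rw [card_eq_sum_ones]
      refine sum_le_sum fun u hu => ?_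
      -- A vertex of residual degree exactly two has an edge to `S`, as its total degree is not two.
      -- So every vertex of `T` is charged, and the total charge is at most $2k+k(1+k)<5k^2$.
      by_contra! h5
      have h6 := hnc u (hTV hu)
      have h7 := hV2 u (hTV hu)
      have h8 : D u = ∑ w ∈ Sᶜ, M u w := if_neg (hVS u (hTV hu))
      have h9 : ∑ w ∈ S, M u w + ∑ w ∈ Sᶜ, M u w = ∑ w, M u w := sum_add_sum_compl _ _
      have h10 : ∑ s ∈ S, M s u = ∑ w ∈ S, M u w := sum_congr rfl fun s _ => hM.symm s u
      omega
    rw [sum_add_distrib, sum_comm] at h4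
    have h5 : ∑ s ∈ S, ∑ u ∈ A, M s u ≤ k * (1 + k) := by
      refine (sum_le_card_nsmul S _ (1 + k) hatt).trans ?_
      exact Nat.mul_le_mul_right _ ((card_le_card hSX).trans hk)
    have h6 : ∑ u ∈ A, (D u - 2) ≤ ∑ u ∈ V, (D u - 2) := sum_le_sum_of_subset sdiff_subset
    have h7 : k * (1 + k) = k + k * k := by ring
    have h8 : k * k ≠ 0 := by positivity
    omega

end Branching

/-- The vertices of positive residual degree form a core, so `X` meets them. Take `x` to be first
among the vertices of `X` there, by degree with ties broken by `<`: everything ranked before `x`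
avoids `X` and has at least its degree, and `card_lt_of_resDeg_le` applies. -/
theorem exists_mem_rank_lt {α : Type*} [Fintype α] [LinearOrder α] {M : α → α → ℕ}
    {S X : Finset α} (hM : IsLoopless M) {k : ℕ} (hX : HitsTwice M X) (hSX : S ⊆ X)
    (hk : #X ≤ k) (h1 : ∀ u ∉ S, ∀ v, M u v ≤ 1) (hc : ∀ u v, ¬ Contractible M S u v)
    (hnd : ¬ IsDone M S) :
    ∃ x ∈ X, 0 < resDeg M S x ∧ rank (resDeg M S) x < 5 * (k * k) := by
  set D := resDeg M S with hD
  set V := univ.filter (0 < D ·) with hV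
  have hVS : ∀ u ∈ V, u ∉ S := fun u hu hS => by simp [hV, hD, resDeg, hS] at hu
  have hpos : ∀ u ∉ S, ∀ v ∉ S, M u v ≠ 0 → u ∈ V := fun u hu v hv h => by
    refine mem_filter.2 ⟨mem_univ _, ?_⟩
    rw [hD, resDeg, if_neg hu, outDeg]
    exact (Nat.pos_of_ne_zero h).trans_le
      (single_le_sum (f := fun x => M u x) (fun _ _ => Nat.zero_le _) (mem_compl.2 hv))
  have hD2 : ∀ u ∈ V, 2 ≤ D u := fun u hu => by
    have h0 : 0 < D u := (mem_filter.1 hu).2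
    have he : D u = outDeg M S u := if_neg (hVS u hu)
    obtain ⟨w, hw, h⟩ : ∃ w ∈ Sᶜ, M u w ≠ 0 := by
      by_contra! h
      rw [he, outDeg, sum_eq_zero h] at h0
      omega
    have : D u ≠ 1 := fun h3 =>
      hc u w ⟨hVS u hu, mem_compl.1 hw, h, Or.inl (he ▸ h3)⟩
    omega
  have hcore : IsCore M V := by
    constructor
    · unfold IsDone at hnd
      push Not at hnd
      obtain ⟨u, v, hu, h | h⟩ := hnd
      · have := h1 u hu v
        omega
      · exact ⟨u, hpos u hu v h.1 h.2⟩
    · exact fun u hu => (hD2 u hu).trans (resDeg_eq_sum hM (hVS u hu)).le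
  have hne : (V ∩ X).Nonempty := card_pos.1 (by have := hX V hcore; omega)
  obtain ⟨x, hx, hmax⟩ := exists_max_image (V ∩ X) (fun u => toLex (D u, u)) hne
  rw [mem_inter] at hx
  refine ⟨x, hx.2, (mem_filter.1 hx.1).2, ?_⟩
  refine card_lt_of_resDeg_le hM (δ := D x) hX hSX hk hc ?_ (hD2 x hx.1)
    ((card_pos.2 ⟨x, hx.2⟩).trans_le hk) ?_ ?_
  · intro y hy
    by_cases hyV : y ∈ V
    · have := hmax y (mem_inter.2 ⟨hyV, hy⟩)
      rw [Prod.Lex.toLex_le_toLex] at this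
      rcases this with h | h
      · exact h.le
      · exact h.1.le
    · have : ¬ 0 < D y := fun h => hyV (mem_filter.2 ⟨mem_univ _, h⟩)
      change D y ≤ D x
      omega
  · intro y hy
    rcases (mem_filter.1 hy).2 with h | h
    · exact h.le
    · exact h.1.le
  · rw [disjoint_left]
    intro y hy hyX
    have hy : D x < D y ∨ (D x = D y ∧ x < y) := (mem_filter.1 hy).2
    have hyV : y ∈ V := by
      have := hD2 x hx.1
      have : D x ≤ D y := hy.elim (fun h => h.le) fun h => h.1.le
      exact mem_filter.2 ⟨mem_univ _, show 0 < D y by omega⟩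
    have := hmax y (mem_inter.2 ⟨hyV, hyX⟩)
    rw [Prod.Lex.toLex_le_toLex] at this
    rcases this with h | h <;> rcases hy with h' | h'
    · omega
    · omega
    · omega
    · exact absurd h.2 (not_le.2 h'.2)

end MultMatrix

/-! ### Bounded iteration and exhaustive search for a pair -/

/-- `f (m - 1) (… (f 1 (f 0 s)))`. -/
def iter {σ : Type*} (f : ℕ → σ → σ) : ℕ → σ → σ
  | 0, s => s
  | m + 1, s => f m (iter f m s)

theorem iter_induction {σ : Type*} {f : ℕ → σ → σ} (I : ℕ → σ → Prop) {m : ℕ} {s : σ}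
    (h0 : I 0 s) (h : ∀ i < m, ∀ s, I i s → I (i + 1) (f i s)) : I m (iter f m s) := by
  induction m with
  | zero => exact h0
  | succ m ih => exact h m m.lt_succ_self _ (ih fun i hi => h i (hi.trans m.lt_succ_self))

open Classical in
/-- The last pair, in lexicographic order, with the property `P`. -/
noncomputable def pick {n : ℕ} (P : Fin n → Fin n → Prop) : Option (Fin n × Fin n) :=
  iter (fun u => iter (fun v o =>
    if h : ∃ (hu : u < n) (hv : v < n), P ⟨u, hu⟩ ⟨v, hv⟩ then some (⟨u, h.1⟩, ⟨v, h.2.1⟩) else o) n)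
    n none

/-- Correctness of the algorithm needs only these two properties. The definition by nested iteration
fixes which pair is found, so that the double loop of the program computes the same one. -/
theorem pick_spec {n : ℕ} (P : Fin n → Fin n → Prop) :
    (∀ p, pick P = some p → P p.1 p.2) ∧ (pick P = none → ∀ u v, ¬ P u v) := by
  have key := iter_induction (σ := Option (Fin n × Fin n)) (m := n) (s := none)
    (f := fun u => iter (fun v o => open Classical in
      if h : ∃ (hu : u < n) (hv : v < n), P ⟨u, hu⟩ ⟨v, hv⟩ then some (⟨u, h.1⟩, ⟨v, h.2.1⟩)
      else o) n)
    (fun i o => (∀ p, o = some p → P p.1 p.2) ∧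
      (o = none → ∀ u v : Fin n, (u : ℕ) < i → ¬ P u v)) (by simp) (by
    intro i hi o ho
    have := iter_induction (σ := Option (Fin n × Fin n)) (m := n) (s := o)
      (f := fun v o => open Classical in
        if h : ∃ (hu : i < n) (hv : v < n), P ⟨i, hu⟩ ⟨v, hv⟩ then some (⟨i, h.1⟩, ⟨v, h.2.1⟩)
        else o)
      (fun j o => (∀ p, o = some p → P p.1 p.2) ∧
        (o = none → ∀ u v : Fin n, (u : ℕ) < i ∨ ((u : ℕ) = i ∧ (v : ℕ) < j) → ¬ P u v))
      ⟨ho.1, fun h u v h' => ho.2 h u v (by omega)⟩ (by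
      intro j hj o ho
      split_ifs with h
      · refine ⟨fun p hp => ?_, fun h => by simp at h⟩
        obtain rfl := Option.some.inj hp
        exact h.2.2
      · refine ⟨ho.1, fun h' u v huv hP => ?_⟩
        by_cases huv' : (u : ℕ) = i ∧ (v : ℕ) = j
        · obtain ⟨rfl, rfl⟩ := huv'
          exact h ⟨hi, hj, hP⟩
        · exact ho.2 h' u v (by omega) hP)
    refine ⟨this.1, fun h u v huv => this.2 h u v ?_⟩
    have := v.2
    omega)
  exact ⟨key.1, fun h u v => key.2 h u v u.2⟩

/-! ### The algorithm guided by a choice code -/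

namespace MultMatrix

open Finset

variable {n : ℕ}

/-- The current multigraph, the current partial solution and the code of the remaining choices. -/
abbrev Config (n : ℕ) : Type := (Fin n → Fin n → ℕ) × Finset (Fin n) × ℕ

/-- `u` has to be taken because of parallel edges. -/
def Forced (M : Fin n → Fin n → ℕ) (S : Finset (Fin n)) (u v : Fin n) : Prop :=
  u ∉ S ∧ 2 ≤ M u v

/-- `u` is the vertex number `d` by degree. -/
def Chosen (M : Fin n → Fin n → ℕ) (S : Finset (Fin n)) (d : ℕ) (u _v : Fin n) : Prop :=
  0 < resDeg M S u ∧ rank (resDeg M S) u = d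

/-- One step of the algorithm. -/
noncomputable def algStep (q : ℕ) (x : Config n) : Config n :=
  match pick (Forced x.1 x.2.1) with
  | some p => (x.1, insert p.1 x.2.1, x.2.2)
  | none =>
    match pick (Contractible x.1 x.2.1) with
    | some p => (contract x.1 p.1 p.2, x.2.1, x.2.2)
    | none =>
      match pick (Chosen x.1 x.2.1 (x.2.2 % q)) with
      | some p => (x.1, insert p.1 x.2.1, x.2.2 / q)
      | none => (x.1, x.2.1, x.2.2 / q)

theorem le_one_of_pick_forced {M : Fin n → Fin n → ℕ} {S : Finset (Fin n)}
    (h : pick (Forced M S) = none) : ∀ u ∉ S, ∀ v, M u v ≤ 1 := fun u hu v => by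
  by_contra! h2
  exact (pick_spec _).2 h u v ⟨hu, h2⟩

/-- Solutions of the configuration `y` are solutions of the configuration `x`. -/
def Refines (y x : Config n) : Prop :=
  IsLoopless y.1 ∧ x.2.1 ⊆ y.2.1 ∧ ∀ X, y.2.1 ⊆ X → HitsTwice y.1 X → HitsTwice x.1 X

/-- Soundness of every step, whatever the code. A contraction takes place only when no vertex is
forced, so the edges at the contracted vertex are simple, as `HitsTwice.of_contract` requires. -/
theorem refines_algStep (q : ℕ) {x : Config n} (hM : IsLoopless x.1) :
    Refines (algStep q x) x := by
  unfold algStep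
  split
  · exact ⟨hM, subset_insert _ _, fun _ _ h => h⟩
  · split
    · rename_i _ h _ p hp
      have hc := (pick_spec _).1 p hp
      exact ⟨hM.contract _ _, Subset.rfl, fun X hX h' =>
        h'.of_contract hM (le_one_of_pick_forced h p.1 hc.1) hc hX⟩
    · split
      · exact ⟨hM, subset_insert _ _, fun _ _ h => h⟩
      · exact ⟨hM, Subset.rfl, fun _ _ h => h⟩

theorem refines_iterate (q : ℕ) {x : Config n} (hM : IsLoopless x.1) (j : ℕ) :
    Refines ((algStep q)^[j] x) x := by
  induction j with
  | zero => exact ⟨hM, Subset.rfl, fun _ _ h => h⟩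
  | succ j ih =>
    rw [Function.iterate_succ_apply']
    have := refines_algStep q ih.1
    exact ⟨this.1, ih.2.1.trans this.2.1, fun X hX h =>
      ih.2.2 X (this.2.1.trans hX) (this.2.2 X hX h)⟩

/-- The number of vertices outside `S` that are not isolated. -/
noncomputable def potential (M : Fin n → Fin n → ℕ) (S : Finset (Fin n)) : ℕ :=
  #{u | u ∉ S ∧ ∃ v, M u v ≠ 0}

theorem potential_insert {M : Fin n → Fin n → ℕ} {S : Finset (Fin n)} {u v : Fin n}
    (hu : u ∉ S) (h : M u v ≠ 0) : potential M (insert u S) < potential M S := by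
  refine card_lt_card (ssubset_iff_of_subset (fun w hw => ?_) |>.2 ⟨u, ?_, by simp⟩)
  · simp only [mem_filter, mem_univ, true_and, mem_insert, not_or] at hw ⊢
    exact ⟨hw.1.2, hw.2⟩
  · simpa using ⟨hu, v, h⟩

/-- The vertex `u` becomes isolated. Any other vertex with an edge afterwards had one before,
possibly to `u`. -/
theorem potential_contract {M : Fin n → Fin n → ℕ} (hM : IsLoopless M) {S : Finset (Fin n)}
    {u v : Fin n} (hu : u ∉ S) (h : M u v ≠ 0) :
    potential (contract M u v) S < potential M S := by
  refine card_lt_card (ssubset_iff_of_subset (fun w hw => ?_) |>.2 ⟨u, ?_, ?_⟩)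
  · simp only [mem_filter, mem_univ, true_and] at hw ⊢
    obtain ⟨hwS, y, hy⟩ := hw
    refine ⟨hwS, ?_⟩
    have := hM.symm v u
    unfold contract at hy
    split_ifs at hy with h1 h2 h3
    · exact absurd rfl hy
    · exact ⟨u, by subst h2; omega⟩
    · by_cases h4 : M w y = 0
      · exact ⟨u, by omega⟩
      · exact ⟨y, h4⟩
    · exact ⟨y, hy⟩
  · simpa using ⟨hu, v, h⟩
  · simp [contract]

theorem isDone_of_potential_eq_zero {M : Fin n → Fin n → ℕ} {S : Finset (Fin n)}
    (h : potential M S = 0) : IsDone M S := by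
  rintro u v ⟨hu, h2⟩
  rw [potential, card_eq_zero, filter_eq_empty_iff] at h
  exact h (mem_univ u) ⟨hu, v, by omega⟩

theorem IsDone.not_forced {M : Fin n → Fin n → ℕ} {S : Finset (Fin n)} (h : IsDone M S) :
    pick (Forced M S) = none := by
  cases hp : pick (Forced M S) with
  | none => rfl
  | some p =>
    have := (pick_spec _).1 p hp
    exact absurd ⟨this.1, Or.inl this.2⟩ (h p.1 p.2)

theorem IsDone.not_contractible {M : Fin n → Fin n → ℕ} {S : Finset (Fin n)} (h : IsDone M S) :
    pick (Contractible M S) = none := by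
  cases hp : pick (Contractible M S) with
  | none => rfl
  | some p =>
    have := (pick_spec _).1 p hp
    exact absurd ⟨this.1, Or.inr ⟨this.2.1, this.2.2.1⟩⟩ (h p.1 p.2)

theorem IsDone.not_chosen {M : Fin n → Fin n → ℕ} {S : Finset (Fin n)} (h : IsDone M S) (d : ℕ) :
    pick (Chosen M S d) = none := by
  cases hp : pick (Chosen M S d) with
  | none => rfl
  | some p =>
    have := ((pick_spec _).1 p hp).1
    rw [resDeg] at this
    split_ifs at this with hS
    · omega
    · obtain ⟨w, hw, h0⟩ := exists_ne_zero_of_sum_ne_zero this.ne'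
      exact absurd ⟨hS, Or.inr ⟨mem_compl.1 hw, h0⟩⟩ (h p.1 w)

/-- A finished configuration changes only its code, so a fixed number of steps can be run without
testing for termination. -/
theorem IsDone.iterate (q : ℕ) (j : ℕ) {x : Config n} (h : IsDone x.1 x.2.1) :
    ((algStep q)^[j] x).1 = x.1 ∧ ((algStep q)^[j] x).2.1 = x.2.1 := by
  induction j generalizing x with
  | zero => exact ⟨rfl, rfl⟩
  | succ j ih =>
    have h1 : algStep q x = (x.1, x.2.1, x.2.2 / q) := by
      simp only [algStep, h.not_forced, h.not_contractible, h.not_chosen]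
    rw [Function.iterate_succ_apply, h1]
    exact ih (x := (x.1, x.2.1, x.2.2 / q)) h

/-- The number of choices for a branching step. -/
def branching (k : ℕ) : ℕ := 5 * (k * k) + 1

theorem branching_pos (k : ℕ) : 0 < branching k := Nat.succ_pos _

/-- With the choice code `c`, the algorithm finds in `j` steps a solution of size at most `k`. -/
def Succeeds (k j c : ℕ) (M : Fin n → Fin n → ℕ) (S : Finset (Fin n)) : Prop :=
  IsDone ((algStep (branching k))^[j] (M, S, c)).1 ((algStep (branching k))^[j] (M, S, c)).2.1 ∧
    #((algStep (branching k))^[j] (M, S, c)).2.1 ≤ k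

theorem IsDone.exists_code {k : ℕ} (j : ℕ) {M : Fin n → Fin n → ℕ} {S : Finset (Fin n)}
    (hk : #S ≤ k) (hd : IsDone M S) :
    ∃ c < (branching k) ^ (k - #S), Succeeds k j c M S := by
  refine ⟨0, pow_pos (branching_pos k) _, ?_⟩
  · obtain ⟨e1, e2⟩ := IsDone.iterate (branching k) j (x := (M, S, 0)) hd
    rw [Succeeds, e1, e2]
    exact ⟨hd, hk⟩

/-- Some choice code leads to a solution if there is one. -/
theorem exists_code {k : ℕ} (j : ℕ) {M : Fin n → Fin n → ℕ} {S X : Finset (Fin n)}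
    (hM : IsLoopless M) (hSX : S ⊆ X) (hk : #X ≤ k) (hX : HitsTwice M X)
    (hj : potential M S ≤ j) :
    ∃ c < (branching k) ^ (k - #S), Succeeds k j c M S := by
  -- The solution must vary too, because a contraction may exchange one of its vertices.
  induction j generalizing M S X with
  | zero =>
    exact (isDone_of_potential_eq_zero (Nat.le_zero.1 hj)).exists_code 0
      ((card_le_card hSX).trans hk)
  | succ j ih =>
    by_cases hd : IsDone M S
    · exact hd.exists_code (j + 1) ((card_le_card hSX).trans hk)
    simp only [Succeeds] at ih ⊢
    simp only [Function.iterate_succ_apply]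
    have hins : ∀ {u}, u ∉ S → u ∈ X → insert u S ⊆ X ∧ #(insert u S) = #S + 1 ∧ #S < k :=
      fun {u} hu hX => by
        have h1 := insert_subset hX hSX
        have h2 := card_insert_of_notMem hu
        have h3 := card_le_card h1
        exact ⟨h1, h2, by omega⟩
    cases h1 : pick (Forced M S) with
    | some p =>
      have hp := (pick_spec _).1 p h1
      obtain ⟨h2, h3, h4⟩ := hins hp.1 (hX.mem_of_two_le hM hp.2)
      have h5 := potential_insert (M := M) (v := p.2) hp.1 (by have := hp.2; omega)
      obtain ⟨c, hc, h6⟩ := ih hM h2 hk hX (by omega)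
      refine ⟨c, hc.trans_le (Nat.pow_le_pow_right (branching_pos k) (by omega)), ?_⟩
      · simpa only [algStep, h1] using h6
    | none =>
      have hone := le_one_of_pick_forced h1
      cases h2 : pick (Contractible M S) with
      | some p =>
        have hp := (pick_spec _).1 p h2
        obtain ⟨X', hS', hk', hX'⟩ := hX.exists_contract hM (hone _ hp.1) hp hSX
        have h5 := potential_contract hM hp.1 hp.2.2.1
        obtain ⟨c, hc, h6⟩ := ih (hM.contract p.1 p.2) hS' (hk'.trans hk) hX' (by omega)
        exact ⟨c, hc, by simpa only [algStep, h1, h2] using h6⟩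
      | none =>
        obtain ⟨x, hx, hx0, hr⟩ := exists_mem_rank_lt hM hX hSX hk hone ((pick_spec _).2 h2) hd
        -- The additional one in `branching k` is not needed for the choice; it makes the base
        -- positive also for `k = 0`.
        replace hr := hr.trans (Nat.lt_succ_self _)
        change _ < branching k at hr
        have hch : pick (Chosen M S (rank (resDeg M S) x)) ≠ none := fun h =>
          (pick_spec _).2 h x x ⟨hx0, rfl⟩
        obtain ⟨p, hp⟩ := Option.ne_none_iff_exists'.1 hch
        have hpx : p.1 = x := rank_injective _ ((pick_spec _).1 p hp).2
        have hxS : x ∉ S := fun h => by simp [resDeg, h] at hx0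
        obtain ⟨h3, h4, h5⟩ := hins hxS hx
        obtain ⟨y, hy⟩ : ∃ y, M x y ≠ 0 := by
          by_contra! h
          simp [resDeg, outDeg, h] at hx0
        have h6 := potential_insert hxS hy
        obtain ⟨c, hc, h7⟩ := ih hM h3 hk hX (by omega)
        -- The lowest digit is the choice for this step and is read by `%`; `/` passes the remaining
        -- digits to the later steps. One more vertex in `S` pays for one more digit.
        refine ⟨rank (resDeg M S) x + branching k * c, ?_, ?_⟩
        · obtain ⟨m, hm⟩ : ∃ m, k - #S = m + 1 := ⟨k - #S - 1, by omega⟩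
          rw [hm, pow_succ, mul_comm _ (branching k)]
          have h8 : k - #(insert x S) = m := by omega
          rw [h8] at hc
          calc _ < branching k + branching k * c := by omega
            _ = branching k * (c + 1) := by ring
            _ ≤ _ := Nat.mul_le_mul_left _ hc
        · simpa only [algStep, h1, h2, Nat.add_mul_mod_self_left, Nat.mod_eq_of_lt hr, hp, hpx,
            Nat.add_mul_div_left _ _ (Nat.zero_lt_of_lt hr), Nat.div_eq_of_lt hr, zero_add] using h7

end MultMatrix

/-! ### Fault tolerant feedback vertex sets as sets hitting every core twice -/

namespace Graph

open Finset MultMatrix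

variable {α β : Type*} {G : Graph α β}

theorem multiplicity_le_one_of_forall_eq {x y : α} {e₀ : β}
    (h : ∀ e, G.IsLink e x y → e = e₀) : G.multiplicity x y ≤ 1 := by
  rw [← Set.ncard_singleton e₀]
  exact Set.ncard_le_ncard (fun e he => h e he)

theorem exists_isLink_of_multiplicity_ne_zero {x y : α} (h : G.multiplicity x y ≠ 0) :
    ∃ e, G.IsLink e x y :=
  (Set.nonempty_of_ncard_ne_zero h)

/-- A walk inside a core can always leave a vertex by an edge other than the one it arrived by: a
single edge accounts for only one neighbour and multiplicity one. -/
theorem exists_isLink_ne_of_two_le_sum [DecidableEq α] {B : Finset α} {v : α}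
    (h : 2 ≤ ∑ w ∈ B, G.multiplicity v w) (e₀ : β) :
    ∃ e, ∃ w ∈ B, e ≠ e₀ ∧ G.IsLink e v w := by
  by_contra! hcon
  have heq : ∀ w ∈ B, ∀ e, G.IsLink e v w → e = e₀ := fun w hw e he => by
    by_contra hne
    exact hcon e w hw hne he
  obtain ⟨w, hw, hw0⟩ := exists_ne_zero_of_sum_ne_zero (show ∑ w ∈ B, G.multiplicity v w ≠ 0 by omega)
  obtain ⟨e, he⟩ := exists_isLink_of_multiplicity_ne_zero hw0
  rw [← add_sum_erase _ _ hw, sum_eq_zero] at h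
  · have := multiplicity_le_one_of_forall_eq (heq w hw)
    omega
  · intro y hy
    by_contra hy0
    obtain ⟨e', he'⟩ := exists_isLink_of_multiplicity_ne_zero hy0
    rw [heq y (mem_of_mem_erase hy) e' he'] at he'
    rw [heq w hw e he] at he
    exact ne_of_mem_erase hy (he'.right_unique he)

/-- Finiteness matters because `Set.ncard` is zero on infinite sets of parallel edges. -/
theorem two_le_sum_multiplicity [DecidableEq α] (hE : G.edgeSet.Finite) {B : Finset α}
    {v w w' : α} {e e' : β} (he : G.IsLink e v w) (he' : G.IsLink e' v w') (hne : e ≠ e')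
    (hw : w ∈ B) (hw' : w' ∈ B) : 2 ≤ ∑ w ∈ B, G.multiplicity v w := by
  have hfin : ∀ y, {e | G.IsLink e v y}.Finite := fun y =>
    hE.subset fun e (he : G.IsLink e v y) => he.edge_mem
  by_cases h : w = w'
  · subst h
    refine le_trans ?_ (single_le_sum (fun _ _ => Nat.zero_le _) hw)
    exact (Set.one_lt_ncard (hfin w)).2 ⟨e, he, e', he', hne⟩
  · have h1 : 0 < G.multiplicity v w := (Set.ncard_pos (hfin w)).2 ⟨e, he⟩
    have h2 : 0 < G.multiplicity v w' := (Set.ncard_pos (hfin w')).2 ⟨e', he'⟩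
    have h3 : ∑ y ∈ {w, w'}, G.multiplicity v y ≤ ∑ w ∈ B, G.multiplicity v w :=
      sum_le_sum_of_subset (by simp [insert_subset_iff, hw, hw'])
    rw [sum_pair h] at h3
    omega

/-- A closed part of an infinite walk that never takes an edge twice in a row is a cycle, if it is
as short as possible. -/
theorem exists_isCycle_of_walk [G.Loopless] (x : ℕ → α) (e : ℕ → β)
    (hl : ∀ i, G.IsLink (e i) (x i) (x (i + 1))) (hne : ∀ i, e (i + 1) ≠ e i)
    (hrep : ∃ i j, i < j ∧ x i = x j) :
    ∃ (i l : ℕ), G.IsCycle (fun t : Fin (l + 1) => x (i + t)) (fun t => e (i + t)) := by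
  classical
  have hex : ∃ d, 0 < d ∧ ∃ i, x i = x (i + d) := by
    obtain ⟨i, j, hij, h⟩ := hrep
    exact ⟨j - i, by omega, i, by rw [Nat.add_sub_cancel' hij.le]; exact h⟩
  obtain ⟨hd, i, hi⟩ := Nat.find_spec hex
  have hmin := fun m => Nat.find_min hex (m := m)
  obtain ⟨l, hl'⟩ : ∃ l, Nat.find hex = l + 1 := ⟨Nat.find hex - 1, by omega⟩
  rw [hl'] at hi hmin
  have hinj : ∀ a b, a < b → b < l + 1 → x (i + a) ≠ x (i + b) := fun a b hab hb h =>
    hmin (b - a) (by omega) ⟨by omega, i + a, by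
      rw [h]; congr 1; omega⟩
  have hedge : ∀ a b, a < b → b < l + 1 → e (i + a) ≠ e (i + b) := fun a b hab hb h => by
    have h1 := hl (i + a)
    rw [h] at h1
    -- An edge used twice is traversed in the same or in the opposite direction. Either way a vertex
    -- repeats at a shorter distance, except when the two uses are consecutive, which `hne`
    -- excludes.
    rcases h1.eq_and_eq_or_eq_and_eq (hl (i + b)) with h2 | h2
    · exact hinj a b hab hb h2.1
    · by_cases hbl : b + 1 < l + 1
      · exact hinj a (b + 1) (by omega) hbl h2.1
      · have hb' : b = l := by omega
        subst hb'
        rcases Nat.eq_zero_or_pos a with rfl | ha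
        · by_cases hb1 : b = 1
          · subst hb1
            exact hne i h.symm
          · exact hinj 1 b (by omega) hb h2.2
        · exact hinj 0 a ha (by omega) (by rw [h2.1]; exact hi)
  refine ⟨i, l, ?_, ?_, ?_⟩
  · intro a b hab
    rcases lt_trichotomy (a : ℕ) b with h | h | h
    · exact absurd hab (hinj a b h b.2)
    · exact Fin.ext h
    · exact absurd hab.symm (hinj b a h a.2)
  · intro a b hab
    rcases lt_trichotomy (a : ℕ) b with h | h | h
    · exact absurd hab (hedge a b h b.2)
    · exact Fin.ext h
    · exact absurd hab.symm (hedge b a h a.2)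
  · intro t
    have h := hl (i + t)
    simp only [Fin.val_add_one]
    split_ifs with ht
    · subst ht
      rw [add_zero, hi]
      exact h
    · exact h

/-- Walk inside `B` forever without using an edge twice in a row; as `B` is finite, some vertex
repeats. -/
theorem exists_isCycle_of_isCore [DecidableEq α] [G.Loopless] {B : Finset α}
    (hB : IsCore G.multiplicity B) :
    ∃ (l : ℕ) (v : Fin (l + 1) → α) (e : Fin (l + 1) → β), G.IsCycle v e ∧ ∀ i, v i ∈ B := by
  obtain ⟨v₀, hv₀⟩ := hB.1
  obtain ⟨w, hw, hw0⟩ := exists_ne_zero_of_sum_ne_zero (s := B) (f := G.multiplicity v₀)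
    (by have := hB.2 v₀ hv₀; omega)
  obtain ⟨e₀, -⟩ := exists_isLink_of_multiplicity_ne_zero hw0
  have hstep : ∀ p : B × β, ∃ p' : B × β, p'.2 ≠ p.2 ∧ G.IsLink p'.2 p.1 p'.1 := fun p => by
    obtain ⟨e, w, hw, hne, hl⟩ := exists_isLink_ne_of_two_le_sum (hB.2 p.1 p.1.2) p.2
    exact ⟨(⟨w, hw⟩, e), hne, hl⟩
  choose f hf using hstep
  let s : ℕ → B × β := fun i => f^[i] (⟨v₀, hv₀⟩, e₀)
  have hs : ∀ i, s (i + 1) = f (s i) := fun i => Function.iterate_succ_apply' _ _ _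
  obtain ⟨i, l, h⟩ := exists_isCycle_of_walk (G := G) (fun i => ((s i).1 : α)) (fun i => (s (i + 1)).2)
    (fun i => by rw [hs]; exact (hf (s i)).2) (fun i => by rw [hs (i + 1)]; exact (hf _).1) (by
      obtain ⟨i, j, hij, h⟩ := Finite.exists_ne_map_eq_of_infinite fun i => (s i).1
      rcases lt_or_gt_of_ne hij with h' | h'
      · exact ⟨i, j, h', congrArg _ h⟩
      · exact ⟨j, i, h', congrArg _ h.symm⟩)
  exact ⟨l, _, _, h, fun t => (s (i + t)).1.2⟩

theorem IsCycle.isCore [DecidableEq α] [G.Loopless] (hE : G.edgeSet.Finite) {l : ℕ}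
    {v : Fin (l + 1) → α} {e : Fin (l + 1) → β} (h : G.IsCycle v e) :
    IsCore G.multiplicity (univ.image v) := by
  refine ⟨⟨v 0, mem_image_of_mem _ (mem_univ _)⟩, fun x hx => ?_⟩
  obtain ⟨i, -, rfl⟩ := mem_image.1 hx
  have h1 := h.2.2 (i - 1)
  rw [sub_add_cancel] at h1
  refine two_le_sum_multiplicity hE (h.2.2 i) h1.symm (fun he => ?_)
    (mem_image_of_mem _ (mem_univ _)) (mem_image_of_mem _ (mem_univ _))
  have h2 := h.2.1 he
  -- The edges before and after a vertex coincide only in a cycle of length one, that is, a loop.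
  rw [eq_comm, sub_eq_self, Fin.one_eq_zero_iff] at h2
  obtain rfl : l = 0 := by omega
  have h3 := (h.2.2 0).ne
  exact h3 (congrArg v (Subsingleton.elim (α := Fin 1) _ _))

theorem IsCycle.mono {H : Graph α β} (hHG : H ≤ G) {l : ℕ} {v : Fin (l + 1) → α}
    {e : Fin (l + 1) → β} (h : H.IsCycle v e) : G.IsCycle v e :=
  ⟨h.1, h.2.1, fun i => (h.2.2 i).mono hHG⟩

/-- If a core `B` has at most one vertex in `X`, take `F = B ∩ X`: a cycle inside `B` survives.
Conversely, a surviving cycle meets `X` only in `F`, although its vertices form a core. -/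
theorem isFaultTolerantFVS_one_iff [DecidableEq α] [G.Loopless] (hV : G.vertexSet = Set.univ)
    (hE : G.edgeSet.Finite) (X : Finset α) :
    G.IsFaultTolerantFVS 1 (X : Set α) ↔ HitsTwice G.multiplicity X := by
  constructor
  · intro h B hB
    by_contra! hlt
    obtain ⟨l, v, e, hc, hv⟩ := exists_isCycle_of_isCore hB
    refine h.2 ↑(B ∩ X) (by simp [hV]) ?_ l v e ⟨hc.1, hc.2.1, fun i => ?_⟩
    · rw [Set.encard_coe_eq_coe_finsetCard]
      exact_mod_cast Nat.lt_succ_iff.1 hlt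
    · rw [deleteVerts_isLink]
      refine ⟨hc.2.2 i, ?_, ?_⟩ <;> simp [hv]
  · intro h
    refine ⟨by simp [hV], fun F _ hF l v e hc => ?_⟩
    have hc' := hc.mono deleteVerts_le
    have h1 := h _ (hc'.isCore hE)
    have h2 : ((univ.image v ∩ X : Finset α) : Set α) ⊆ F := by
      intro x hx
      rw [mem_coe, mem_inter] at hx
      obtain ⟨i, -, rfl⟩ := mem_image.1 hx.1
      have h3 := ((deleteVerts_isLink G _).1 (hc.2.2 i)).2.1
      by_contra hxF
      exact h3 ⟨hx.2, hxF⟩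
    have h3 := (Set.encard_le_encard h2).trans hF
    rw [Set.encard_coe_eq_coe_finsetCard] at h3
    have : #(univ.image v ∩ X) ≤ 1 := by exact_mod_cast h3
    omega

theorem isLoopless_multiplicity (G : Graph α β) [G.Loopless] : IsLoopless G.multiplicity where
  symm u v := by simp only [multiplicity, isLink_comm]
  diag u := by
    have : {e | G.IsLink e u u} = ∅ := Set.eq_empty_of_forall_notMem fun e he => he.ne rfl
    rw [multiplicity, this, Set.ncard_empty]

end Graph

/-! ## A structured language with bounded loops, compiled to random access machines -/

namespace RAM

@[simp]
theorem State.reg_setReg (s : State) (r x i : ℕ) :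
    (s.setReg r x).reg i = if i = r then x else s.reg i := by
  simp [State.setReg, Function.update_apply]

@[simp]
theorem State.mem_setReg (s : State) (r x : ℕ) : (s.setReg r x).mem = s.mem := rfl

@[simp]
theorem State.reg_setMem (s : State) (a x : ℕ) : (s.setMem a x).reg = s.reg := rfl

@[simp]
theorem State.mem_setMem (s : State) (a x i : ℕ) :
    (s.setMem a x).mem i = if i = a then x else s.mem i := by
  simp [State.setMem, Function.update_apply]

/-- Expressions; a product has a register as its second factor. -/
inductive Exp where
  | var (r : ℕ) : Exp
  | lit (c : ℕ) : Exp
  | add (a b : Exp) : Exp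
  | sub (a b : Exp) : Exp
  | mul (a : Exp) (r : ℕ) : Exp
  | get (a : Exp) : Exp
  | ite (c a b : Exp) : Exp

/-- The value of an expression. -/
def Exp.val : Exp → State → ℕ
  | var r, s => s.reg r
  | lit c, _ => c
  | add a b, s => a.val s + b.val s
  | sub a b, s => a.val s - b.val s
  | mul a r, s => a.val s * s.reg r
  | get a, s => s.mem (a.val s)
  | ite c a b, s => if c.val s ≠ 0 then a.val s else b.val s

/-- All variables are smaller than `v`, and second factors are smaller than `κ`. -/
def Exp.wf (v κ : ℕ) : Exp → Bool
  | var r => r < v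
  | lit _ => true
  | add a b => a.wf v κ && b.wf v κ
  | sub a b => a.wf v κ && b.wf v κ
  | mul a r => a.wf v κ && decide (r < κ)
  | get a => a.wf v κ
  | ite c a b => c.wf v κ && (a.wf v κ && b.wf v κ)

/-- A program that puts the value of an expression into register `t`, using registers from `t`
on. -/
def Exp.compile : Exp → ℕ → Prog
  | var r, t => .copy t r
  | lit c, t => .const t c
  | add a b, t => .seq (a.compile t) (.seq (b.compile (t + 1)) (.add t t (t + 1)))
  | sub a b, t => .seq (a.compile t) (.seq (b.compile (t + 1)) (.sub t t (t + 1)))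
  | mul a r, t => .seq (a.compile t) (.seq (.copy (t + 1) r) (.seq (.const (t + 2) 0)
      (.seq (.const (t + 3) 1) (.seq
        (.while (t + 1) (.seq (.add (t + 2) (t + 2) t) (.sub (t + 1) (t + 1) (t + 3))))
        (.copy t (t + 2))))))
  | get a, t => .seq (a.compile t) (.load t t)
  | ite c a b, t => .seq (c.compile t) (.ite t (a.compile t) (b.compile t))

/-- A bound for the running time if the constant registers are at most `N`. -/
def Exp.cost : Exp → ℕ → ℕ
  | var _, _ => 1
  | lit _, _ => 1
  | add a b, N => a.cost N + (b.cost N + 1)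
  | sub a b, N => a.cost N + (b.cost N + 1)
  | mul a _, N => a.cost N + (N * 3 + 5)
  | get a, N => a.cost N + 1
  | ite c a b, N => c.cost N + (a.cost N + (b.cost N + 1))

/-- The states agree on the memory and on the registers smaller than `v`. -/
def Agree (v : ℕ) (s s' : State) : Prop := (∀ r < v, s'.reg r = s.reg r) ∧ s'.mem = s.mem

theorem Agree.refl (v : ℕ) (s : State) : Agree v s s := ⟨fun _ _ => rfl, rfl⟩

theorem Agree.trans {v : ℕ} {s₁ s₂ s₃ : State} (h : Agree v s₁ s₂) (h' : Agree v s₂ s₃) :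
    Agree v s₁ s₃ :=
  ⟨fun r hr => (h'.1 r hr).trans (h.1 r hr), h'.2.trans h.2⟩

theorem Agree.mono {v w : ℕ} {s s' : State} (h : Agree w s s') (hvw : v ≤ w) : Agree v s s' :=
  ⟨fun r hr => h.1 r (hr.trans_le hvw), h.2⟩

theorem Agree.setReg {v : ℕ} {s s' : State} (h : Agree v s s') (x c : ℕ) :
    Agree v (s.setReg x c) (s'.setReg x c) :=
  ⟨fun r hr => by simp [h.1 r hr], h.2⟩

theorem Agree.setReg_right {v : ℕ} {s s' : State} (h : Agree v s s') {r : ℕ} (hr : v ≤ r)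
    (c : ℕ) : Agree v s (s'.setReg r c) :=
  ⟨fun i hi => by simp [(hi.trans_le hr).ne, h.1 i hi], h.2⟩

theorem Exp.val_congr {v κ : ℕ} (hκ : κ ≤ v) {s s' : State} (h : Agree v s s') (e : Exp)
    (he : e.wf v κ) : e.val s' = e.val s := by
  induction e with
  | var r => exact h.1 r (by simpa [wf] using he)
  | lit c => rfl
  | add a b iha ihb | sub a b iha ihb =>
    simp only [wf, Bool.and_eq_true] at he
    simp only [val, iha he.1, ihb he.2]
  | mul a r iha =>
    simp only [wf, Bool.and_eq_true, decide_eq_true_eq] at he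
    simp only [val, iha he.1, h.1 r (he.2.trans_le hκ)]
  | get a iha =>
    simp only [wf] at he
    simp only [val, iha he, h.2]
  | ite c a b ihc iha ihb =>
    simp only [wf, Bool.and_eq_true] at he
    simp only [val, ihc he.1, iha he.2.1, ihb he.2.2]

/-- Rule for loops that count down `m` rounds of at most `b` steps each. -/
theorem exec_while {r b : ℕ} {p : Prog} (J : ℕ → State → Prop)
    (h0 : ∀ s, J 0 s → s.reg r = 0)
    (hs : ∀ m s, J (m + 1) s → s.reg r ≠ 0 ∧ ∃ T s', Exec p s T s' ∧ T ≤ b ∧ J m s')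
    (m : ℕ) (s : State) (hJ : J m s) :
    ∃ T s', Exec (.while r p) s T s' ∧ T ≤ m * (b + 1) + 1 ∧ J 0 s' := by
  induction m generalizing s with
  | zero => exact ⟨1, s, .while_done (h0 s hJ), by omega, hJ⟩
  | succ m ih =>
    obtain ⟨hr, T, s', he, hT, hJ'⟩ := hs m s hJ
    obtain ⟨T', s'', he', hT', hJ''⟩ := ih s' hJ'
    refine ⟨_, s'', .while_step hr he he', ?_, hJ''⟩
    rw [Nat.succ_mul]
    omega

/-- Registers from `t` on act as a stack: the second operand is compiled at `t + 1` and leaves the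
first one intact. The bound `N` limits the loops that carry out multiplications. -/
theorem Exp.exec_compile {v κ N : ℕ} (hκ : κ ≤ v) (e : Exp) (he : e.wf v κ) (t : ℕ) (ht : v ≤ t)
    (s : State) (hN : ∀ r < κ, s.reg r ≤ N) :
    ∃ T s', Exec (e.compile t) s T s' ∧ T ≤ e.cost N ∧ s'.reg t = e.val s ∧ Agree t s s' := by
  induction e generalizing t s with
  | var r => exact ⟨1, _, .copy t r s, le_rfl, by simp [val], (Agree.refl _ _).setReg_right le_rfl _⟩
  | lit c => exact ⟨1, _, .const t c s, le_rfl, by simp [val], (Agree.refl _ _).setReg_right le_rfl _⟩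
  | add a b iha ihb =>
    simp only [wf, Bool.and_eq_true] at he
    obtain ⟨T₁, s₁, h₁, hT₁, hv₁, ha₁⟩ := iha he.1 t ht s hN
    obtain ⟨T₂, s₂, h₂, hT₂, hv₂, ha₂⟩ := ihb he.2 (t + 1) (by omega) s₁
      fun r hr => (ha₁.1 r (by omega)).trans_le (hN r hr)
    refine ⟨_, _, .seq h₁ (.seq h₂ (.add _ _ _ _)), by simp only [cost]; omega, ?_,
      (ha₁.trans (ha₂.mono (by omega))).setReg_right le_rfl _⟩
    simp [val, hv₂, ha₂.1 t (by omega), hv₁, b.val_congr hκ (ha₁.mono ht) he.2]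
  | sub a b iha ihb =>
    simp only [wf, Bool.and_eq_true] at he
    obtain ⟨T₁, s₁, h₁, hT₁, hv₁, ha₁⟩ := iha he.1 t ht s hN
    obtain ⟨T₂, s₂, h₂, hT₂, hv₂, ha₂⟩ := ihb he.2 (t + 1) (by omega) s₁
      fun r hr => (ha₁.1 r (by omega)).trans_le (hN r hr)
    refine ⟨_, _, .seq h₁ (.seq h₂ (.sub _ _ _ _)), by simp only [cost]; omega, ?_,
      (ha₁.trans (ha₂.mono (by omega))).setReg_right le_rfl _⟩
    simp [val, hv₂, ha₂.1 t (by omega), hv₁, b.val_congr hκ (ha₁.mono ht) he.2]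
  | mul a r iha =>
    simp only [wf, Bool.and_eq_true, decide_eq_true_eq] at he
    obtain ⟨T₁, s₁, h₁, hT₁, hv₁, ha₁⟩ := iha he.1 t ht s hN
    have hr₁ : s₁.reg r = s.reg r := ha₁.1 r (by omega)
    -- Multiplication by repeated addition: the partial product in `t + 2` plus the part still to be
    -- added is the product.
    obtain ⟨T₂, s₂, h₂, hT₂, hJ⟩ := exec_while (r := t + 1) (b := 2)
      (p := .seq (.add (t + 2) (t + 2) t) (.sub (t + 1) (t + 1) (t + 3)))
      (fun m s' => s'.reg (t + 1) = m ∧ s'.reg (t + 2) + a.val s * m = a.val s * s.reg r ∧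
        s'.reg t = a.val s ∧ s'.reg (t + 3) = 1 ∧ Agree t s s')
      (fun s' h => h.1)
      (fun m s' ⟨h1, h2, h3, h4, h5⟩ => ⟨by omega, _, _, .seq (.add _ _ _ _) (.sub _ _ _ _), le_rfl,
        by simp [h1, h4], by simp [h3, ← h2]; ring, by simp [h3], by simp [h4],
        (h5.setReg_right (by omega) _).setReg_right (by omega) _⟩)
      (s.reg r) (((s₁.setReg (t + 1) (s₁.reg r)).setReg (t + 2) 0).setReg (t + 3) 1)
      ⟨by simp [hr₁], by simp, by simp [hv₁], by simp,
        ((ha₁.setReg_right (by omega) _).setReg_right (by omega) _).setReg_right (by omega) _⟩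
    refine ⟨_, _, .seq h₁ (.seq (.copy _ _ _) (.seq (.const _ _ _) (.seq (.const _ _ _)
      (.seq h₂ (.copy _ _ _))))), ?_, ?_, hJ.2.2.2.2.setReg_right le_rfl _⟩
    · have := hN r he.2
      simp only [cost]
      omega
    · simpa [val] using hJ.2.1
  | get a iha =>
    simp only [wf] at he
    obtain ⟨T₁, s₁, h₁, hT₁, hv₁, ha₁⟩ := iha he t ht s hN
    exact ⟨_, _, .seq h₁ (.load _ _ _), by simp only [cost]; omega, by simp [val, hv₁, ha₁.2],
      ha₁.setReg_right le_rfl _⟩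
  | ite c a b ihc iha ihb =>
    simp only [wf, Bool.and_eq_true] at he
    obtain ⟨T₁, s₁, h₁, hT₁, hv₁, ha₁⟩ := ihc he.1 t ht s hN
    have hN₁ : ∀ r < κ, s₁.reg r ≤ N := fun r hr => (ha₁.1 r (by omega)).trans_le (hN r hr)
    by_cases h0 : c.val s = 0
    · obtain ⟨T₂, s₂, h₂, hT₂, hv₂, ha₂⟩ := ihb he.2.2 t ht s₁ hN₁
      refine ⟨_, _, .seq h₁ (.ite_false (by omega) h₂), by simp only [cost]; omega, ?_,
        ha₁.trans ha₂⟩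
      simp [val, h0, hv₂, b.val_congr hκ (ha₁.mono ht) he.2.2]
    · obtain ⟨T₂, s₂, h₂, hT₂, hv₂, ha₂⟩ := iha he.2.1 t ht s₁ hN₁
      refine ⟨_, _, .seq h₁ (.ite_true (by omega) h₂), by simp only [cost]; omega, ?_,
        ha₁.trans ha₂⟩
      simp [val, h0, hv₂, a.val_congr hκ (ha₁.mono ht) he.2.1]

/-- Commands. -/
inductive Cmd where
  /-- `assign x e`: put the value of `e` into register `x`. -/
  | assign (x : ℕ) (e : Exp) : Cmd
  /-- `put a e`: put the value of `e` into the memory cell with address `a`. -/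
  | put (a e : Exp) : Cmd
  | seq (c d : Cmd) : Cmd
  /-- `cond e c`: run `c` if the value of `e` is nonzero. -/
  | cond (e : Exp) (c : Cmd) : Cmd
  /-- `loop x r c`: run `c` for all values of register `x` smaller than the content of
  register `r`. -/
  | loop (x r : ℕ) (c : Cmd) : Cmd

/-- The effect of a command. -/
def Cmd.run : Cmd → State → State
  | assign x e, s => s.setReg x (e.val s)
  | put a e, s => s.setMem (a.val s) (e.val s)
  | seq c d, s => d.run (c.run s)
  | cond e c, s => if e.val s ≠ 0 then c.run s else s
  | loop x r c, s => iter (fun i s => c.run (s.setReg x i)) (s.reg r) s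

/-- All variables are smaller than `v`, and the constant registers, those smaller than `κ`, are
not changed but bound all loops. -/
def Cmd.wf (v κ : ℕ) : Cmd → Bool
  | assign x e => decide (κ ≤ x) && (decide (x < v) && e.wf v κ)
  | put a e => a.wf v κ && e.wf v κ
  | seq c d => c.wf v κ && d.wf v κ
  | cond e c => e.wf v κ && c.wf v κ
  | loop x r c => decide (κ ≤ x) && (decide (x < v) && (decide (r < κ) && c.wf v κ))

/-- A program for a command that uses auxiliary registers from `t` on. -/
def Cmd.compile : Cmd → ℕ → Prog
  | assign x e, t => .seq (e.compile t) (.copy x t)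
  | put a e, t => .seq (a.compile t) (.seq (e.compile (t + 1)) (.store t (t + 1)))
  | seq c d, t => .seq (c.compile t) (d.compile t)
  | cond e c, t => .seq (e.compile t) (.ite t (c.compile t) .skip)
  | loop x r c, t => .seq (.copy t r) (.seq (.const (t + 1) 0) (.seq (.const (t + 2) 1)
      (.while t (.seq (.copy x (t + 1)) (.seq (c.compile (t + 3))
        (.seq (.add (t + 1) (t + 1) (t + 2)) (.sub t t (t + 2))))))))

/-- A bound for the running time if the constant registers are at most `N`. -/
def Cmd.cost : Cmd → ℕ → ℕ
  | assign _ e, N => e.cost N + 1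
  | put a e, N => a.cost N + (e.cost N + 1)
  | seq c d, N => c.cost N + d.cost N
  | cond e c, N => e.cost N + (c.cost N + 2)
  | loop _ _ c, N => N * (c.cost N + 4) + 4

theorem Cmd.run_reg_of_lt {v κ : ℕ} (c : Cmd) (hc : c.wf v κ) (s : State) (r : ℕ) (hr : r < κ) :
    (c.run s).reg r = s.reg r := by
  induction c generalizing s with
  | assign x e =>
    simp only [wf, Bool.and_eq_true, decide_eq_true_eq] at hc
    simp [run, show r ≠ x by omega]
  | put a e => rfl
  | seq c d ihc ihd =>
    simp only [wf, Bool.and_eq_true] at hc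
    simp only [run, ihd hc.2, ihc hc.1]
  | cond e c ih =>
    simp only [wf, Bool.and_eq_true] at hc
    simp only [run]
    split_ifs
    · exact ih hc.2 s
    · rfl
  | loop x r' c ih =>
    simp only [wf, Bool.and_eq_true, decide_eq_true_eq] at hc
    refine iter_induction (fun _ (s' : State) => s'.reg r = s.reg r) rfl fun i _ s' h => ?_
    rw [ih hc.2.2.2, State.reg_setReg, if_neg (by omega), h]

/-- The last clause protects the auxiliary registers of enclosing loops, which lie between `v` and
`t`. Since constant registers never change, the same `N` bounds all nested loops. -/
theorem Cmd.exec_compile {v κ N : ℕ} (hκ : κ ≤ v) (c : Cmd) (hc : c.wf v κ) (t : ℕ) (ht : v ≤ t)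
    (s s' : State) (hs : Agree v s s') (hN : ∀ r < κ, s.reg r ≤ N) :
    ∃ T s'', Exec (c.compile t) s' T s'' ∧ T ≤ c.cost N ∧ Agree v (c.run s) s'' ∧
      ∀ r, v ≤ r → r < t → s''.reg r = s'.reg r := by
  induction c generalizing t s s' with
  | assign x e =>
    simp only [wf, Bool.and_eq_true, decide_eq_true_eq] at hc
    obtain ⟨T₁, s₁, h₁, hT₁, hv₁, ha₁⟩ := e.exec_compile hκ hc.2.2 t ht s' (N := N)
      fun r hr => (hs.1 r (by omega)).trans_le (hN r hr)
    refine ⟨_, _, .seq h₁ (.copy _ _ _), by simp only [cost]; omega, ?_, fun r hr hrt => ?_⟩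
    · rw [run, hv₁, e.val_congr hκ hs hc.2.2]
      exact (hs.trans (ha₁.mono ht)).setReg _ _
    · simp [show r ≠ x by omega, ha₁.1 r hrt]
  | put a e =>
    simp only [wf, Bool.and_eq_true] at hc
    have hN' : ∀ r < κ, s'.reg r ≤ N := fun r hr => (hs.1 r (by omega)).trans_le (hN r hr)
    obtain ⟨T₁, s₁, h₁, hT₁, hv₁, ha₁⟩ := a.exec_compile hκ hc.1 t ht s' hN'
    obtain ⟨T₂, s₂, h₂, hT₂, hv₂, ha₂⟩ := e.exec_compile hκ hc.2 (t + 1) (by omega) s₁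
      fun r hr => (ha₁.1 r (by omega)).trans_le (hN' r hr)
    have ha := hs.trans ((ha₁.mono ht).trans (ha₂.mono (by omega)))
    refine ⟨_, _, .seq h₁ (.seq h₂ (.store _ _ _)), by simp only [cost]; omega, ⟨?_, ?_⟩,
      fun r hr hrt => ?_⟩
    · exact ha.1
    · funext i
      simp [run, ha₂.1 t (by omega), hv₁, hv₂, e.val_congr hκ (hs.trans (ha₁.mono ht)) hc.2,
        a.val_congr hκ hs hc.1, ha.2]
    · simp [ha₂.1 r (by omega), ha₁.1 r hrt]
  | seq c d ihc ihd =>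
    simp only [wf, Bool.and_eq_true] at hc
    obtain ⟨T₁, s₁, h₁, hT₁, ha₁, hr₁⟩ := ihc hc.1 t ht s s' hs hN
    obtain ⟨T₂, s₂, h₂, hT₂, ha₂, hr₂⟩ := ihd hc.2 t ht _ s₁ ha₁
      fun r hr => (c.run_reg_of_lt hc.1 s r hr).trans_le (hN r hr)
    exact ⟨_, _, .seq h₁ h₂, by simp only [cost]; omega, ha₂,
      fun r hr hrt => (hr₂ r hr hrt).trans (hr₁ r hr hrt)⟩
  | cond e c ih =>
    simp only [wf, Bool.and_eq_true] at hc
    obtain ⟨T₁, s₁, h₁, hT₁, hv₁, ha₁⟩ := e.exec_compile hκ hc.1 t ht s' (N := N)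
      fun r hr => (hs.1 r (by omega)).trans_le (hN r hr)
    have ha := hs.trans (ha₁.mono ht)
    rw [e.val_congr hκ hs hc.1] at hv₁
    by_cases h0 : e.val s = 0
    · refine ⟨_, _, .seq h₁ (.ite_false (by omega) (.skip _)), by simp only [cost]; omega, ?_,
        fun r _ hrt => ha₁.1 r hrt⟩
      simpa [run, h0] using ha
    · obtain ⟨T₂, s₂, h₂, hT₂, ha₂, hr₂⟩ := ih hc.2 t ht s s₁ ha hN
      refine ⟨_, _, .seq h₁ (.ite_true (by omega) h₂), by simp only [cost]; omega, ?_,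
        fun r hr hrt => (hr₂ r hr hrt).trans (ha₁.1 r hrt)⟩
      simpa [run, h0] using ha₂
  | loop x r c ih =>
    simp only [wf, Bool.and_eq_true, decide_eq_true_eq] at hc
    obtain ⟨hx, hxv, hr, hc⟩ := hc
    let f : ℕ → State → State := fun i s => c.run (s.setReg x i)
    have hconst : ∀ i, ∀ r < κ, (iter f i s).reg r = s.reg r := fun i r hr => by
      refine iter_induction (fun _ (s' : State) => s'.reg r = s.reg r) rfl fun i _ s' h => ?_
      change (c.run _).reg r = _
      rw [c.run_reg_of_lt hc _ r hr, State.reg_setReg, if_neg (by omega), h]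
    -- Register `t` counts the remaining rounds, `t + 1` the finished ones, and `t + 2` holds the
    -- constant one. The body may overwrite `x`, which is reloaded from `t + 1`.
    obtain ⟨T₂, s₂, h₂, hT₂, i, hi, -, -, -, ha, hrt⟩ := exec_while (r := t) (b := c.cost N + 3)
      (p := .seq (.copy x (t + 1)) (.seq (c.compile (t + 3))
        (.seq (.add (t + 1) (t + 1) (t + 2)) (.sub t t (t + 2)))))
      (fun m s₁ => ∃ i, i + m = s.reg r ∧ s₁.reg t = m ∧ s₁.reg (t + 1) = i ∧ s₁.reg (t + 2) = 1 ∧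
        Agree v (iter f i s) s₁ ∧ ∀ r, v ≤ r → r < t → s₁.reg r = s'.reg r)
      (fun s₁ ⟨i, h⟩ => h.2.1) (by
        rintro m s₁ ⟨i, h1, h2, h3, h4, h5, h6⟩
        obtain ⟨T₃, s₃, h₃, hT₃, ha₃, hr₃⟩ := ih hc (t + 3) (by omega) _ _
          (h5.setReg x (s₁.reg (t + 1)))
          (fun r hr => by
            rw [State.reg_setReg, if_neg (by omega), hconst i r hr]
            exact hN r hr)
        have e1 : s₃.reg (t + 1) = i := by
          rw [hr₃ _ (by omega) (by omega), State.reg_setReg, if_neg (by omega), h3]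
        have e2 : s₃.reg (t + 2) = 1 := by
          rw [hr₃ _ (by omega) (by omega), State.reg_setReg, if_neg (by omega), h4]
        have e3 : s₃.reg t = m + 1 := by
          rw [hr₃ _ (by omega) (by omega), State.reg_setReg, if_neg (by omega), h2]
        refine ⟨by omega, _, _, .seq (.copy _ _ _) (.seq h₃ (.seq (.add _ _ _ _) (.sub _ _ _ _))),
          by omega, i + 1, by omega, by simp [e2, e3], by simp [e1, e2], by simp [e2], ?_, ?_⟩
        · rw [h3] at ha₃
          exact (ha₃.setReg_right (by omega) _).setReg_right ht _
        · intro r' hr' hrt'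
          simp [show r' ≠ t by omega, show r' ≠ t + 1 by omega, hr₃ r' hr' (by omega),
            show r' ≠ x by omega, h6 r' hr' hrt'])
      (s.reg r) (((s'.setReg t (s'.reg r)).setReg (t + 1) 0).setReg (t + 2) 1)
      ⟨0, by omega, by simp [hs.1 r (by omega)], by simp, by simp,
        ((hs.setReg_right ht _).setReg_right (by omega) _).setReg_right (by omega) _,
        fun r' _ _ => by
          simp [show r' ≠ t by omega, show r' ≠ t + 1 by omega, show r' ≠ t + 2 by omega]⟩
    refine ⟨_, _, .seq (.copy _ _ _) (.seq (.const _ _ _) (.seq (.const _ _ _) h₂)), ?_, ?_, hrt⟩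
    · have := Nat.mul_le_mul_right (c.cost N + 4) (hN r hr)
      change T₂ ≤ s.reg r * (c.cost N + 4) + 1 at hT₂
      simp only [cost]
      omega
    · rw [add_zero] at hi
      rw [hi] at ha
      exact ha

/-- `f` is bounded by a polynomial. -/
def PolyBounded (f : ℕ → ℕ) : Prop := ∃ a d, ∀ N, f N ≤ a * (N + 1) ^ d

theorem PolyBounded.const (c : ℕ) : PolyBounded fun _ => c := ⟨c, 0, fun N => by simp⟩

theorem PolyBounded.id : PolyBounded fun N => N := ⟨1, 1, fun N => by simp⟩

theorem PolyBounded.add {f g : ℕ → ℕ} (hf : PolyBounded f) (hg : PolyBounded g) :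
    PolyBounded fun N => f N + g N := by
  obtain ⟨a, d, hf⟩ := hf
  obtain ⟨b, e, hg⟩ := hg
  refine ⟨a + b, max d e, fun N => ?_⟩
  rw [add_mul]
  refine add_le_add ((hf N).trans ?_) ((hg N).trans ?_) <;> gcongr <;> simp

theorem PolyBounded.mul {f g : ℕ → ℕ} (hf : PolyBounded f) (hg : PolyBounded g) :
    PolyBounded fun N => f N * g N := by
  obtain ⟨a, d, hf⟩ := hf
  obtain ⟨b, e, hg⟩ := hg
  refine ⟨a * b, d + e, fun N => (Nat.mul_le_mul (hf N) (hg N)).trans_eq ?_⟩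
  ring

theorem Exp.polyBounded_cost (e : Exp) : PolyBounded e.cost := by
  induction e with
  | var _ | lit _ => exact .const 1
  | add a b iha ihb | sub a b iha ihb => exact iha.add (ihb.add (.const 1))
  | mul a r iha => exact iha.add ((PolyBounded.id.mul (.const 3)).add (.const 5))
  | get a iha => exact iha.add (.const 1)
  | ite c a b ihc iha ihb => exact ihc.add (iha.add (ihb.add (.const 1)))

theorem Cmd.polyBounded_cost (c : Cmd) : PolyBounded c.cost := by
  induction c with
  | assign x e => exact e.polyBounded_cost.add (.const 1)
  | put a e => exact a.polyBounded_cost.add (e.polyBounded_cost.add (.const 1))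
  | seq c d ihc ihd => exact ihc.add ihd
  | cond e c ih => exact e.polyBounded_cost.add (ih.add (.const 2))
  | loop x r c ih => exact (PolyBounded.id.mul (ih.add (.const 4))).add (.const 4)

end RAM

/-! ## Tables in memory -/

namespace RAM

/-- The memory as a table with rows of length `n`. -/
def State.at (s : State) {n : ℕ} (i : ℕ) (j : Fin n) : ℕ := s.mem (i * n + j)

theorem address_inj {n i i' : ℕ} {j j' : Fin n} :
    i * n + j = i' * n + j' ↔ i = i' ∧ j = j' := by
  constructor
  · intro h
    have hn := j.pos
    have h1 := congrArg (· / n) h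
    have h2 := congrArg (· % n) h
    simp only [mul_comm _ n,
      Nat.mul_add_div hn, Nat.div_eq_of_lt j.2, Nat.div_eq_of_lt j'.2, Nat.mul_add_mod,
      Nat.mod_eq_of_lt j.2, Nat.mod_eq_of_lt j'.2] at h1 h2
    exact ⟨by simpa using h1, Fin.ext h2⟩
  · rintro ⟨rfl, rfl⟩
    rfl

theorem State.at_setMem (s : State) {n : ℕ} (i i' x : ℕ) (j j' : Fin n) :
    (s.setMem (i' * n + j') x).at i j = if i = i' ∧ j = j' then x else s.at i j := by
  simp [State.at, address_inj]

@[simp]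
theorem State.at_setReg (s : State) {n : ℕ} (r x i : ℕ) (j : Fin n) :
    (s.setReg r x).at i j = s.at i j := rfl

/-- `s'` differs from `s` only in the given registers and rows. -/
structure Frame (n : ℕ) (regs : List ℕ) (rows : ℕ → Prop) (s s' : State) : Prop where
  reg : ∀ r ∉ regs, s'.reg r = s.reg r
  row : ∀ i (j : Fin n), ¬ rows i → s'.at i j = s.at i j

section Frame

variable {n : ℕ} {regs regs' : List ℕ} {rows rows' : ℕ → Prop} {s s' s'' : State}

theorem Frame.refl (n : ℕ) (regs : List ℕ) (rows : ℕ → Prop) (s : State) :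
    Frame n regs rows s s :=
  ⟨fun _ _ => rfl, fun _ _ _ => rfl⟩

theorem Frame.trans (h : Frame n regs rows s s') (h' : Frame n regs rows s' s'') :
    Frame n regs rows s s'' :=
  ⟨fun r hr => (h'.reg r hr).trans (h.reg r hr),
    fun i j hi => (h'.row i j hi).trans (h.row i j hi)⟩

theorem Frame.mono (h : Frame n regs rows s s') (hr : regs ⊆ regs')
    (hi : ∀ i, rows i → rows' i) : Frame n regs' rows' s s' :=
  ⟨fun r hr' => h.reg r fun h' => hr' (hr h'), fun i j hi' => h.row i j fun h' => hi' (hi i h')⟩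

theorem Frame.setReg (h : Frame n regs rows s s') {r : ℕ} (hr : r ∈ regs) (x : ℕ) :
    Frame n regs rows s (s'.setReg r x) :=
  ⟨fun i hi => by rw [State.reg_setReg, if_neg (by rintro rfl; exact hi hr), h.reg i hi], h.row⟩

theorem Frame.setMem (h : Frame n regs rows s s') {i : ℕ} (hi : rows i) (j : Fin n) (x : ℕ) :
    Frame n regs rows s (s'.setMem (i * n + j) x) :=
  ⟨h.reg, fun i' j' hi' => by
    rw [State.at_setMem, if_neg (by rintro ⟨rfl, -⟩; exact hi' hi), h.row i' j' hi']⟩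

end Frame

/-- The address of an entry of the table; register `0` holds the length of the rows. -/
def cell (i j : Exp) : Exp := .add (.mul i 0) j

/-- An entry of the table. -/
def fetch (i j : Exp) : Exp := .get (cell i j)

theorem val_cell {n : ℕ} {s : State} (h0 : s.reg 0 = n) {i j : Exp} {I : ℕ} {J : Fin n}
    (hi : i.val s = I) (hj : j.val s = J) : (cell i j).val s = I * n + J := by
  simp [cell, Exp.val, h0, hi, hj]

theorem val_fetch {n : ℕ} {s : State} (h0 : s.reg 0 = n) {i j : Exp} {I : ℕ} {J : Fin n}
    (hi : i.val s = I) (hj : j.val s = J) : (fetch i j).val s = s.at I J := by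
  rw [fetch, Exp.val, val_cell h0 hi hj, State.at]

theorem Cmd.run_loop {x r m : ℕ} {c : Cmd} {s : State} (h : s.reg r = m) :
    (Cmd.loop x r c).run s = iter (fun i s => c.run (s.setReg x i)) m s := by
  subst h
  rfl

/-- Put into register `10` the sum of `e` over the values of register `9` smaller than `n`. -/
def sumCmd (e : Exp) : Cmd :=
  .seq (.assign 10 (.lit 0)) (.loop 9 0 (.assign 10 (.add (.var 10) e)))

/-- The expression is evaluated inside the loop, so its value has to be known in every state that
differs from `s` in the loop's own registers. The rules for tables below have the same form, with
the row being written also allowed to differ. -/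
theorem run_sumCmd {n : ℕ} {s : State} (h0 : s.reg 0 = n) (e : Exp) (f : Fin n → ℕ)
    (he : ∀ s', Frame n [9, 10] (fun _ => False) s s' → ∀ v : Fin n, s'.reg 9 = v →
      e.val s' = f v) :
    Frame n [9, 10] (fun _ => False) s ((sumCmd e).run s) ∧
      ((sumCmd e).run s).reg 10 = ∑ v, f v := by
  have key := iter_induction (m := n) (s := s.setReg 10 0)
    (f := fun i s => (Cmd.assign 10 (.add (.var 10) e)).run (s.setReg 9 i))
    (fun i s' => Frame n [9, 10] (fun _ => False) s s' ∧
      s'.reg 10 = ∑ v ∈ Finset.range i, if h : v < n then f ⟨v, h⟩ else 0)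
    ⟨(Frame.refl _ _ _ _).setReg (by simp) _, by simp⟩ (by
      rintro i hi s' ⟨h1, h2⟩
      have h3 := h1.setReg (r := 9) (by simp) i
      refine ⟨h3.setReg (by simp) _, ?_⟩
      have h4 := he _ h3 ⟨i, hi⟩ (by simp)
      simp [Cmd.run, Exp.val, h4, h2, Finset.sum_range_succ, hi])
  rw [Finset.sum_fin_eq_sum_range]
  have hrun : (sumCmd e).run s = (Cmd.loop 9 0 (.assign 10 (.add (.var 10) e))).run
      (s.setReg 10 0) := rfl
  rw [hrun, Cmd.run_loop (by simpa using h0)]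
  exact key

/-- Put into the entry `u` of a row, for all `u`, the sum of `e` over the values of register `9`
smaller than `n`, where register `8` is `u`. -/
def tabSum (row e : Exp) : Cmd :=
  .loop 8 0 (.seq (sumCmd e) (.put (cell row (.var 8)) (.var 10)))

theorem run_tabSum {n : ℕ} {s : State} (h0 : s.reg 0 = n) (row e : Exp) (R : ℕ)
    (hR : ∀ s' : State, s'.reg 0 = n → row.val s' = R) (f : Fin n → Fin n → ℕ)
    (he : ∀ s', Frame n [8, 9, 10] (· = R) s s' → ∀ u v : Fin n, s'.reg 8 = u → s'.reg 9 = v →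
      e.val s' = f u v) :
    Frame n [8, 9, 10] (· = R) s ((tabSum row e).run s) ∧
      ∀ u : Fin n, ((tabSum row e).run s).at R u = ∑ v, f u v := by
  have key := iter_induction (m := n) (s := s)
    (f := fun i s => (Cmd.seq (sumCmd e) (.put (cell row (.var 8)) (.var 10))).run (s.setReg 8 i))
    (fun i s' => Frame n [8, 9, 10] (· = R) s s' ∧
      ∀ u : Fin n, (u : ℕ) < i → s'.at R u = ∑ v, f u v)
    ⟨Frame.refl _ _ _ _, by simp⟩ (by
      rintro i hi s' ⟨h1, h2⟩
      have h3 := h1.setReg (r := 8) (by simp) i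
      obtain ⟨h4, h5⟩ := run_sumCmd (n := n) (s := s'.setReg 8 i)
        (by simp [h1.reg 0 (by simp), h0]) e (f ⟨i, hi⟩) fun s'' hs'' v hv =>
        he s'' (h3.trans (hs''.mono (by simp) (by simp))) ⟨i, hi⟩ v
          (by rw [hs''.reg 8 (by simp)]; simp) hv
      have h6 := h3.trans (h4.mono (by simp) (by simp))
      have h8 : ((sumCmd e).run (s'.setReg 8 i)).reg 8 = i := by
        rw [h4.reg 8 (by simp)]; simp
      have h00 : ((sumCmd e).run (s'.setReg 8 i)).reg 0 = n := (h6.reg 0 (by simp)).trans h0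
      simp only [Cmd.run]
      rw [val_cell (J := ⟨i, hi⟩) h00 (hR _ h00) (by simpa [Exp.val] using h8)]
      refine ⟨h6.setMem rfl _ _, fun u hu => ?_⟩
      rw [State.at_setMem]
      split_ifs with h
      · rw [h.2]; exact h5
      · have : (u : ℕ) ≠ i := fun h' => h ⟨rfl, Fin.ext h'⟩
        rw [h4.row R u (by simp), State.at_setReg]
        exact h2 u (by omega))
  rw [tabSum, Cmd.run_loop h0]
  exact ⟨key.1, fun u => key.2 u u.2⟩

/-- Put into the entry `u` of a row, for all `u`, the value of `e`, where register `8` is `u`. -/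
def tabRow (row e : Exp) : Cmd := .loop 8 0 (.put (cell row (.var 8)) e)

theorem run_tabRow {n : ℕ} {s : State} (h0 : s.reg 0 = n) (row e : Exp) (R : ℕ)
    (hR : ∀ s' : State, s'.reg 0 = n → row.val s' = R) (f : Fin n → ℕ)
    (he : ∀ s', Frame n [8] (· = R) s s' → ∀ u : Fin n, s'.reg 8 = u → e.val s' = f u) :
    Frame n [8] (· = R) s ((tabRow row e).run s) ∧
      ∀ u : Fin n, ((tabRow row e).run s).at R u = f u := by
  have key := iter_induction (m := n) (s := s)
    (f := fun i s => (Cmd.put (cell row (.var 8)) e).run (s.setReg 8 i))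
    (fun i s' => Frame n [8] (· = R) s s' ∧ ∀ u : Fin n, (u : ℕ) < i → s'.at R u = f u)
    ⟨Frame.refl _ _ _ _, by simp⟩ (by
      rintro i hi s' ⟨h1, h2⟩
      have h3 := h1.setReg (r := 8) (by simp) i
      have h00 : (s'.setReg 8 i).reg 0 = n := (h3.reg 0 (by simp)).trans h0
      simp only [Cmd.run]
      rw [val_cell (J := ⟨i, hi⟩) h00 (hR _ h00) (by simp [Exp.val])]
      refine ⟨h3.setMem rfl _ _, fun u hu => ?_⟩
      rw [State.at_setMem]
      split_ifs with h
      · rw [h.2]; exact he _ h3 _ (by simp)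
      · have : (u : ℕ) ≠ i := fun h' => h ⟨rfl, Fin.ext h'⟩
        exact h2 u (by omega))
  rw [tabRow, Cmd.run_loop h0]
  exact ⟨key.1, fun u => key.2 u u.2⟩

/-- Put into the entry `v` of row number `u` of a square block, for all `u` and `v`, the value of
`e`, where registers `8` and `9` are `u` and `v`. -/
def tabBlock (row e : Exp) : Cmd :=
  .loop 8 0 (.loop 9 0 (.put (cell (.add row (.var 8)) (.var 9)) e))

theorem run_tabBlock {n : ℕ} {s : State} (h0 : s.reg 0 = n) (row e : Exp) (R : ℕ)
    (hR : ∀ s' : State, s'.reg 0 = n → row.val s' = R) (f : Fin n → Fin n → ℕ)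
    (he : ∀ s', Frame n [8, 9] (fun i => R ≤ i ∧ i < R + n) s s' → ∀ u v : Fin n,
      s'.reg 8 = u → s'.reg 9 = v → e.val s' = f u v) :
    Frame n [8, 9] (fun i => R ≤ i ∧ i < R + n) s ((tabBlock row e).run s) ∧
      ∀ u v : Fin n, ((tabBlock row e).run s).at (R + u) v = f u v := by
  have key := iter_induction (m := n) (s := s)
    (f := fun i s => (Cmd.loop 9 0 (.put (cell (.add row (.var 8)) (.var 9)) e)).run
      (s.setReg 8 i))
    (fun i s' => Frame n [8, 9] (fun i => R ≤ i ∧ i < R + n) s s' ∧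
      ∀ u v : Fin n, (u : ℕ) < i → s'.at (R + u) v = f u v)
    ⟨Frame.refl _ _ _ _, by simp⟩ (by
      rintro i hi s' ⟨h1, h2⟩
      have key := iter_induction (m := n) (s := s'.setReg 8 i)
        (f := fun j s => (Cmd.put (cell (.add row (.var 8)) (.var 9)) e).run (s.setReg 9 j))
        (fun j s' => (Frame n [8, 9] (fun i => R ≤ i ∧ i < R + n) s s' ∧ s'.reg 8 = i) ∧
          ∀ u v : Fin n, (u : ℕ) < i ∨ ((u : ℕ) = i ∧ (v : ℕ) < j) → s'.at (R + u) v = f u v)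
        ⟨⟨h1.setReg (by simp) _, by simp⟩, fun u v h => h2 u v (by omega)⟩ (by
          rintro j hj s' ⟨⟨h1, h8⟩, h2⟩
          have h3 := h1.setReg (r := 9) (by simp) j
          have h00 : (s'.setReg 9 j).reg 0 = n := (h3.reg 0 (by simp)).trans h0
          simp only [Cmd.run]
          rw [val_cell (I := R + i) (J := ⟨j, hj⟩) h00 (by simp [Exp.val, hR _ h00, h8])
            (by simp [Exp.val])]
          refine ⟨⟨h3.setMem (by omega) _ _, by simp [h8]⟩, fun u v hu => ?_⟩
          rw [State.at_setMem]
          split_ifs with h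
          · have : u = ⟨i, hi⟩ := Fin.ext (by have := h.1; simpa using this)
            rw [h.2, this]
            exact he _ h3 _ _ (by simp [h8]) (by simp)
          · have : ¬ ((u : ℕ) = i ∧ (v : ℕ) = j) := fun h' =>
              h ⟨by omega, Fin.ext h'.2⟩
            exact h2 u v (by omega))
      rw [Cmd.run_loop (m := n) (by simp [h1.reg 0 (by simp), h0])]
      exact ⟨key.1.1, fun u v huv => key.2 u v (by omega)⟩)
  rw [tabBlock, Cmd.run_loop h0]
  exact ⟨key.1, fun u v => key.2 u v u.2⟩

/-- Look for values `u`, `v` of the registers `8` and `9` for which `e` is nonzero, and put the last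
ones found into the registers `12` and `13`. -/
def findCmd (e : Exp) : Cmd :=
  .seq (.assign 11 (.lit 0)) (.loop 8 0 (.loop 9 0 (.cond e (.seq (.assign 11 (.lit 1))
    (.seq (.assign 12 (.var 8)) (.assign 13 (.var 9)))))))

/-- The registers `11`, `12` and `13` hold the pair `o`. -/
def Holds {n : ℕ} (o : Option (Fin n × Fin n)) (s : State) : Prop :=
  (o = none ∧ s.reg 11 = 0) ∨ ∃ p, o = some p ∧ s.reg 11 = 1 ∧ s.reg 12 = p.1 ∧ s.reg 13 = p.2

/-- The two loops run in lockstep with the two iterations that define `pick`. -/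
theorem run_findCmd {n : ℕ} {s : State} (h0 : s.reg 0 = n) (e : Exp) (P : Fin n → Fin n → Prop)
    (he : ∀ s', Frame n [8, 9, 11, 12, 13] (fun _ => False) s s' → ∀ u v : Fin n,
      s'.reg 8 = u → s'.reg 9 = v → (e.val s' ≠ 0 ↔ P u v)) :
    Frame n [8, 9, 11, 12, 13] (fun _ => False) s ((findCmd e).run s) ∧
      Holds (pick P) ((findCmd e).run s) := by
  let body : Cmd := .cond e (.seq (.assign 11 (.lit 1))
    (.seq (.assign 12 (.var 8)) (.assign 13 (.var 9))))
  let g : ℕ → ℕ → Option (Fin n × Fin n) → Option (Fin n × Fin n) := fun u v o =>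
    open Classical in
    if h : ∃ (hu : u < n) (hv : v < n), P ⟨u, hu⟩ ⟨v, hv⟩ then some (⟨u, h.1⟩, ⟨v, h.2.1⟩) else o
  have inner : ∀ i < n, ∀ j ≤ n, ∀ s' o,
      Frame n [8, 9, 11, 12, 13] (fun _ => False) s s' → s'.reg 8 = i → Holds o s' →
      let s'' := iter (fun j s => body.run (s.setReg 9 j)) j s'
      Frame n [8, 9, 11, 12, 13] (fun _ => False) s s'' ∧ s''.reg 8 = i ∧
        Holds (iter (g i) j o) s'' := by
    intro i hi j hj s' o h1 h2 h3
    induction j with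
    | zero => exact ⟨h1, h2, h3⟩
    | succ j ih =>
      obtain ⟨h4, h5, h6⟩ := ih (by omega)
      simp only [iter]
      set s₁ := iter (fun j s => body.run (s.setReg 9 j)) j s'
      set o₁ := iter (g i) j o
      have h7 := h4.setReg (r := 9) (by simp) j
      have h8 := he _ h7 ⟨i, hi⟩ ⟨j, by omega⟩ (by simp [h5]) (by simp)
      by_cases hP : P ⟨i, hi⟩ ⟨j, by omega⟩
      · have e1 : g i j o₁ = some (⟨i, hi⟩, ⟨j, by omega⟩) := dif_pos ⟨hi, by omega, hP⟩
        have e2 : body.run (s₁.setReg 9 j) =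
            (((s₁.setReg 9 j).setReg 11 1).setReg 12 i).setReg 13 j := by
          simp [body, Cmd.run, h8.2 hP, Exp.val, h5]
        rw [e1, e2]
        exact ⟨((h7.setReg (by simp) _).setReg (by simp) _).setReg (by simp) _, by simp [h5],
          Or.inr ⟨_, rfl, by simp, by simp, by simp⟩⟩
      · have e1 : g i j o₁ = o₁ := dif_neg fun ⟨_, _, h⟩ => hP h
        have e2 : body.run (s₁.setReg 9 j) = s₁.setReg 9 j := by
          simp only [body, Cmd.run]
          rw [if_neg (fun h => hP (h8.1 h))]
        rw [e1, e2]
        exact ⟨h7, by simp [h5], by simpa [Holds] using h6⟩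
  have outer : ∀ i ≤ n,
      let s'' := iter (fun i s => (Cmd.loop 9 0 body).run (s.setReg 8 i)) i (s.setReg 11 0)
      Frame n [8, 9, 11, 12, 13] (fun _ => False) s s'' ∧
        Holds (iter (fun u => iter (g u) n) i none) s'' := by
    intro i hi
    induction i with
    | zero => exact ⟨(Frame.refl _ _ _ _).setReg (by simp) _, Or.inl ⟨rfl, (State.reg_setReg ..).trans (if_pos rfl)⟩⟩
    | succ i ih =>
      obtain ⟨h1, h2⟩ := ih (by omega)
      simp only [iter]
      have h3 := h1.setReg (r := 8) (by simp) i
      rw [Cmd.run_loop ((h3.reg 0 (by simp)).trans h0)]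
      have h4 := inner i (by omega) n le_rfl _ _ h3 (by simp) (by simpa [Holds] using h2)
      exact ⟨h4.1, h4.2.2⟩
  have hrun : (findCmd e).run s = (Cmd.loop 8 0 (.loop 9 0 body)).run (s.setReg 11 0) := rfl
  rw [hrun, Cmd.run_loop (m := n) (by simpa using h0)]
  exact outer n le_rfl

end RAM

/-! ## The program -/

namespace RAM

open MultMatrix

/-- Negation. -/
def notE (a : Exp) : Exp := .sub (.lit 1) a

/-- Conjunction. -/
def andE (a b : Exp) : Exp := .ite a b (.lit 0)

/-- Disjunction. -/
def orE (a b : Exp) : Exp := .add a b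

/-- `a < b`. -/
def ltE (a b : Exp) : Exp := .sub b a

/-- `a ≤ b`. -/
def leE (a b : Exp) : Exp := .sub (.add b (.lit 1)) a

/-- `a = b`. -/
def eqE (a b : Exp) : Exp := notE (.add (.sub a b) (.sub b a))

theorem val_notE {a : Exp} {s : State} : (notE a).val s ≠ 0 ↔ a.val s = 0 := by
  simp only [notE, Exp.val]; omega

theorem val_andE {a b : Exp} {s : State} : (andE a b).val s ≠ 0 ↔ a.val s ≠ 0 ∧ b.val s ≠ 0 := by
  simp only [andE, Exp.val]; split_ifs <;> simp [*]

theorem val_orE {a b : Exp} {s : State} : (orE a b).val s ≠ 0 ↔ a.val s ≠ 0 ∨ b.val s ≠ 0 := by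
  simp only [orE, Exp.val]; omega

theorem val_ltE {a b : Exp} {s : State} : (ltE a b).val s ≠ 0 ↔ a.val s < b.val s := by
  simp only [ltE, Exp.val]; omega

theorem val_leE {a b : Exp} {s : State} : (leE a b).val s ≠ 0 ↔ a.val s ≤ b.val s := by
  simp only [leE, Exp.val]; omega

theorem val_eqE {a b : Exp} {s : State} : (eqE a b).val s ≠ 0 ↔ a.val s = b.val s := by
  simp only [eqE, notE, Exp.val]; omega

/-- The index of the row `2 n + c`. -/
def rowAt (c : ℕ) : Exp := .add (.add (.var 0) (.var 0)) (.lit c)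

/-- The index of the first row of the current matrix. -/
def rowMat : Exp := .add (.var 0) (.lit 1)

theorem val_rowAt {n : ℕ} (c : ℕ) (s : State) (h : s.reg 0 = n) : (rowAt c).val s = n + n + c := by
  simp [rowAt, Exp.val, h]

theorem val_rowMat {n : ℕ} (s : State) (h : s.reg 0 = n) : rowMat.val s = n + 1 := by
  simp [rowMat, Exp.val, h]

/-- An entry of the current matrix. -/
def matE (a b : Exp) : Exp := fetch (.add rowMat a) b

/-- Membership in the current partial solution. -/
def setE (a : Exp) : Exp := fetch (rowAt 1) a

/-- The memory holds the multigraph `M` and the partial solution `S`. -/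
structure Rep {n : ℕ} (s : State) (M : Fin n → Fin n → ℕ) (S : Finset (Fin n)) : Prop where
  size : s.reg 0 = n
  mat : ∀ u v : Fin n, s.at (n + 1 + u) v = M u v
  set : ∀ u : Fin n, s.at (n + n + 1) u = if u ∈ S then 1 else 0

section Rep

variable {n : ℕ} {s s' : State} {M : Fin n → Fin n → ℕ} {S : Finset (Fin n)}

/-- Rows up to `n` hold the input, rows `n + 1` to `2n` the current matrix and row `2n + 1` the
partial solution. Later rows hold, in turn, residual degrees, degrees, ranks, the saved solution,
and a scratch matrix from `2n + 6` on. -/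
theorem Rep.of_frame (h : Rep s M S) {regs : List ℕ} {rows : ℕ → Prop}
    (hf : Frame n regs rows s s') (h0 : 0 ∉ regs) (hr : ∀ i, rows i → i ≤ n ∨ n + n + 2 ≤ i) :
    Rep s' M S where
  size := (hf.reg 0 h0).trans h.size
  mat u v := by
    rw [hf.row _ _ fun h' => by have := hr _ h'; omega, h.mat]
  set u := by
    rw [hf.row _ _ fun h' => by have := hr _ h'; omega, h.set]

theorem Rep.val_matE (h : Rep s M S) {a b : Exp} {u v : Fin n} (ha : a.val s = u)
    (hb : b.val s = v) : (matE a b).val s = M u v := by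
  rw [matE, val_fetch (I := n + 1 + u) h.size (by simp [Exp.val, val_rowMat s h.size, ha]) hb, h.mat]

theorem Rep.val_setE (h : Rep s M S) {a : Exp} {u : Fin n} (ha : a.val s = u) :
    (setE a).val s = if u ∈ S then 1 else 0 := by
  rw [setE, val_fetch h.size (val_rowAt 1 s h.size) ha, h.set]

theorem Rep.val_setE_ne_zero (h : Rep s M S) {a : Exp} {u : Fin n} (ha : a.val s = u) :
    (setE a).val s ≠ 0 ↔ u ∈ S := by
  rw [h.val_setE ha]; simp

theorem Rep.val_notE_setE (h : Rep s M S) {a : Exp} {u : Fin n} (ha : a.val s = u) :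
    (notE (setE a)).val s ≠ 0 ↔ u ∉ S := by
  rw [val_notE, h.val_setE ha]; simp

/-- Add the vertex in register `12` to the partial solution. -/
def markCmd : Cmd := .put (cell (rowAt 1) (.var 12)) (.lit 1)

theorem Rep.run_markCmd (h : Rep s M S) {u : Fin n} (hu : s.reg 12 = u) :
    Rep (markCmd.run s) M (insert u S) ∧ Frame n [] (· = n + n + 1) s (markCmd.run s) := by
  replace hu : (Exp.var 12).val s = u := hu
  have e : markCmd.run s = s.setMem ((n + n + 1) * n + u) 1 := by
    rw [markCmd, Cmd.run, val_cell h.size (val_rowAt 1 s h.size) hu, Exp.val]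
  rw [e]
  refine ⟨⟨h.size, fun a b => ?_, fun a => ?_⟩, Frame.setMem (rows := (· = n + n + 1)) (Frame.refl _ _ _ _) rfl u 1⟩
  · rw [State.at_setMem, if_neg (by have := a.2; omega), h.mat]
  · rw [State.at_setMem, h.set]
    simp [Finset.mem_insert, ite_or]

/-- The vertex `u` is forced. -/
def forcedE : Exp := andE (notE (setE (.var 8))) (leE (.lit 2) (matE (.var 8) (.var 9)))

theorem Rep.val_forcedE (h : Rep s M S) {u v : Fin n} (hu : s.reg 8 = u) (hv : s.reg 9 = v) :
    forcedE.val s ≠ 0 ↔ Forced M S u v := by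
  replace hu : (Exp.var 8).val s = u := hu
  replace hv : (Exp.var 9).val s = v := hv
  rw [forcedE, val_andE, h.val_notE_setE hu, val_leE, h.val_matE hu hv]
  rfl

/-- The edge from `u` to `v` violates `IsDone`. -/
def undoneE : Exp := andE (notE (setE (.var 8))) (orE (leE (.lit 2) (matE (.var 8) (.var 9)))
  (andE (notE (setE (.var 9))) (matE (.var 8) (.var 9))))

theorem Rep.val_undoneE (h : Rep s M S) {u v : Fin n} (hu : s.reg 8 = u) (hv : s.reg 9 = v) :
    undoneE.val s ≠ 0 ↔ (u ∉ S ∧ (2 ≤ M u v ∨ (v ∉ S ∧ M u v ≠ 0))) := by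
  replace hu : (Exp.var 8).val s = u := hu
  replace hv : (Exp.var 9).val s = v := hv
  rw [undoneE, val_andE, h.val_notE_setE hu, val_orE, val_leE, val_andE, h.val_notE_setE hv,
    h.val_matE hu hv]
  rfl

/-- The terms of the sum `resDeg`. -/
def degE : Exp := .ite (setE (.var 8)) (.lit 0) (.ite (setE (.var 9)) (.lit 0)
  (matE (.var 8) (.var 9)))

theorem Rep.val_degE (h : Rep s M S) {u v : Fin n} (hu : s.reg 8 = u) (hv : s.reg 9 = v) :
    degE.val s = if u ∈ S then 0 else if v ∈ S then 0 else M u v := by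
  simp only [degE, Exp.val, h.val_setE_ne_zero (a := .var 8) hu,
    h.val_setE_ne_zero (a := .var 9) hv, h.val_matE (a := .var 8) (b := .var 9) hu hv]

theorem sum_ite_eq_resDeg (M : Fin n → Fin n → ℕ) (S : Finset (Fin n)) (u : Fin n) :
    (∑ v, if u ∈ S then 0 else if v ∈ S then 0 else M u v) = resDeg M S u := by
  rw [resDeg]
  split_ifs
  · simp
  · rw [outDeg, Finset.sum_ite, Finset.sum_const_zero, zero_add]
    congr 1
    ext
    simp

/-- The edge from `u` to `v` can be contracted. -/
def contractibleE : Exp := andE (notE (setE (.var 8))) (andE (notE (setE (.var 9)))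
  (andE (matE (.var 8) (.var 9)) (orE (eqE (fetch (rowAt 2) (.var 8)) (.lit 1))
    (eqE (fetch (rowAt 3) (.var 8)) (.lit 2)))))

theorem Rep.val_contractibleE (h : Rep s M S) (hd : ∀ u : Fin n, s.at (n + n + 2) u = resDeg M S u)
    (ha : ∀ u : Fin n, s.at (n + n + 3) u = ∑ v, M u v)
    {u v : Fin n} (hu : s.reg 8 = u) (hv : s.reg 9 = v) :
    contractibleE.val s ≠ 0 ↔ Contractible M S u v := by
  replace hu : (Exp.var 8).val s = u := hu
  replace hv : (Exp.var 9).val s = v := hv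
  rw [contractibleE, val_andE, h.val_notE_setE hu, val_andE, h.val_notE_setE hv, val_andE,
    h.val_matE hu hv, val_orE, val_eqE, val_eqE, val_fetch h.size (val_rowAt 2 s h.size) hu,
    val_fetch h.size (val_rowAt 3 s h.size) hu, hd, ha, Contractible]
  refine and_congr_right fun hS => ?_
  rw [resDeg, if_neg hS]
  rfl

/-- The entries of the matrix after a contraction. -/
def contractE : Exp :=
  .ite (orE (eqE (.var 8) (.var 12)) (orE (eqE (.var 9) (.var 12)) (eqE (.var 8) (.var 9)))) (.lit 0)
    (.ite (eqE (.var 8) (.var 13))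
      (.add (matE (.var 8) (.var 9)) (matE (.var 12) (.var 9)))
      (.ite (eqE (.var 9) (.var 13))
        (.add (matE (.var 8) (.var 9)) (matE (.var 8) (.var 12)))
        (matE (.var 8) (.var 9))))

theorem Rep.val_contractE (h : Rep s M S) {u v a b : Fin n} (hu : s.reg 8 = u) (hv : s.reg 9 = v)
    (ha : s.reg 12 = a) (hb : s.reg 13 = b) : contractE.val s = contract M a b u v := by
  simp only [contractE, Exp.val, val_orE, val_eqE, h.val_matE (a := .var 8) (b := .var 9) hu hv,
    h.val_matE (a := .var 12) (b := .var 9) ha hv, h.val_matE (a := .var 8) (b := .var 12) hu ha,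
    hu, hv, ha, hb, Fin.val_inj, contract]

/-- Contract the edge in the registers `12` and `13`. -/
def contractCmd : Cmd := .seq (tabBlock (rowAt 6) contractE)
  (tabBlock rowMat (fetch (.add (rowAt 6) (.var 8)) (.var 9)))

/-- The new entries depend on old entries in other rows, so the new matrix is completed in the
scratch block before it replaces the old one. -/
theorem Rep.run_contractCmd (h : Rep s M S) {a b : Fin n} (ha : s.reg 12 = a)
    (hb : s.reg 13 = b) :
    Rep (contractCmd.run s) (contract M a b) S ∧
      Frame n [8, 9] (fun i => n + 1 ≤ i ∧ i ≠ n + n + 5) s (contractCmd.run s) := by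
  obtain ⟨f₁, h₁⟩ := run_tabBlock h.size (rowAt 6) contractE _ (val_rowAt 6) (contract M a b)
    fun s' hf u v hu hv => (h.of_frame hf (by simp) (by omega)).val_contractE hu hv
      ((hf.reg 12 (by simp)).trans ha) ((hf.reg 13 (by simp)).trans hb)
  set s₁ := (tabBlock (rowAt 6) contractE).run s
  have r₁ := h.of_frame f₁ (by simp) (by omega)
  obtain ⟨f₂, h₂⟩ := run_tabBlock r₁.size rowMat (fetch (.add (rowAt 6) (.var 8)) (.var 9)) _
    val_rowMat (contract M a b) fun s' hf u v hu hv => by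
      have h0 := (hf.reg 0 (by simp)).trans r₁.size
      replace hu : (Exp.var 8).val s' = u := hu
      replace hv : (Exp.var 9).val s' = v := hv
      rw [val_fetch (I := n + n + 6 + u) h0 (by rw [Exp.val, val_rowAt 6 s' h0, hu]) hv,
        hf.row _ _ (by omega), h₁]
  refine ⟨⟨(f₂.reg 0 (by simp)).trans r₁.size, h₂, fun u => ?_⟩,
    (f₁.mono (by simp) (by omega)).trans (f₂.mono (by simp) (by omega))⟩
  exact (f₂.row _ _ (by omega)).trans (r₁.set u)

/-- Put the next choice into register `14` and the code of the remaining ones into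
register `5`. -/
def divCmd : Cmd := .seq (.assign 14 (.var 5)) (.seq (.assign 15 (.lit 0)) (.seq
  (.loop 17 3 (.cond (leE (.var 2) (.var 14)) (.seq (.assign 14 (.sub (.var 14) (.var 2)))
    (.assign 15 (.add (.var 15) (.lit 1))))))
  (.assign 5 (.var 15))))

theorem run_divCmd {s : State} {c q : ℕ} (hc : s.reg 5 = c) (hq : s.reg 2 = q) (hq0 : 0 < q)
    (hQ : c ≤ s.reg 3) (n : ℕ) :
    Frame n [5, 14, 15, 17] (fun _ => False) s (divCmd.run s) ∧
      (divCmd.run s).reg 14 = c % q ∧ (divCmd.run s).reg 5 = c / q := by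
  let body : Cmd := .cond (leE (.var 2) (.var 14)) (.seq (.assign 14 (.sub (.var 14) (.var 2)))
    (.assign 15 (.add (.var 15) (.lit 1))))
  -- Division by repeated subtraction: either the remainder is already below `q`, or a subtraction
  -- has taken place in every round so far.
  obtain ⟨hf, h1, h2⟩ := iter_induction (m := s.reg 3) (s := (s.setReg 14 c).setReg 15 0)
    (f := fun i s => body.run (s.setReg 17 i))
    (fun i s' => Frame n [5, 14, 15, 17] (fun _ => False) s s' ∧
      s'.reg 14 + q * s'.reg 15 = c ∧ (s'.reg 14 < q ∨ s'.reg 15 = i))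
    ⟨((Frame.refl _ _ _ _).setReg (by simp) _).setReg (by simp) _, by simp, by simp⟩ (by
      rintro i - s' ⟨hf, h1, h2⟩
      have hf' := hf.setReg (r := 17) (by simp) i
      have hq' : s'.reg 2 = q := (hf.reg 2 (by simp)).trans hq
      by_cases hle : q ≤ s'.reg 14
      · have e : body.run (s'.setReg 17 i) =
            ((s'.setReg 17 i).setReg 14 (s'.reg 14 - q)).setReg 15 (s'.reg 15 + 1) := by
          simp only [body, Cmd.run]
          rw [if_pos (val_leE.2 (by simpa [Exp.val, hq'] using hle))]
          simp [Exp.val, hq']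
        rw [e]
        refine ⟨(hf'.setReg (by simp) _).setReg (by simp) _, ?_, Or.inr ?_⟩
        · simp only [State.reg_setReg]
          simp only [Nat.reduceEqDiff, if_true, if_false]
          rw [mul_add, mul_one]
          omega
        · simpa using h2.resolve_left (by omega)
      · have e : body.run (s'.setReg 17 i) = s'.setReg 17 i := by
          simp only [body, Cmd.run]
          rw [if_neg fun h => hle (by simpa [Exp.val, hq'] using val_leE.1 h)]
        rw [e]
        exact ⟨hf', by simpa using h1, Or.inl (by simpa using hle)⟩)
  set s₁ := iter (fun i s => body.run (s.setReg 17 i)) (s.reg 3) ((s.setReg 14 c).setReg 15 0)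
  -- If all rounds subtracted, the quotient is at least `c` because `c ≤ s.reg 3`; the remainder is
  -- then zero.
  have hlt : s₁.reg 14 < q := by
    rcases h2 with h2 | h2
    · exact h2
    · have := Nat.mul_le_mul_right (s₁.reg 15) hq0
      by_contra hge
      omega
  have e : divCmd.run s = s₁.setReg 5 (s₁.reg 15) := by
    simp only [divCmd, Cmd.run, Exp.val, hc]
    rfl
  rw [e]
  refine ⟨hf.setReg (by simp) _, ?_, ?_⟩
  · rw [State.reg_setReg, if_neg (by norm_num), ← h1, Nat.add_mul_mod_self_left,
      Nat.mod_eq_of_lt hlt]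
  · rw [State.reg_setReg, if_pos rfl, ← h1, Nat.add_mul_div_left _ _ hq0, Nat.div_eq_of_lt hlt,
      zero_add]

/-- The terms of the sum `rank`. -/
def rankE : Exp := .ite (orE (ltE (fetch (rowAt 2) (.var 8)) (fetch (rowAt 2) (.var 9)))
  (andE (eqE (fetch (rowAt 2) (.var 8)) (fetch (rowAt 2) (.var 9))) (ltE (.var 8) (.var 9))))
  (.lit 1) (.lit 0)

theorem val_rankE {D : Fin n → ℕ} (h0 : s.reg 0 = n) (hd : ∀ u : Fin n, s.at (n + n + 2) u = D u)
    {u v : Fin n} (hu : s.reg 8 = u) (hv : s.reg 9 = v) :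
    rankE.val s = if D u < D v ∨ (D u = D v ∧ u < v) then 1 else 0 := by
  simp only [rankE, Exp.val, val_orE, val_ltE, val_andE, val_eqE,
    val_fetch (j := .var 8) h0 (val_rowAt 2 s h0) hu,
    val_fetch (j := .var 9) h0 (val_rowAt 2 s h0) hv, hd, hu, hv, Fin.val_fin_lt]

/-- The vertex `u` is chosen. -/
def chosenE : Exp := andE (fetch (rowAt 2) (.var 8)) (eqE (fetch (rowAt 4) (.var 8)) (.var 14))

/-- The branching step. -/
def branchCmd : Cmd := .seq divCmd (.seq (tabSum (rowAt 4) rankE)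
  (.seq (findCmd chosenE) (.cond (.var 11) markCmd)))

/-- The steps for an instance without forced vertices. -/
def reduceCmd : Cmd := .seq (tabSum (rowAt 2) degE) (.seq (tabSum (rowAt 3) (matE (.var 8) (.var 9)))
  (.seq (findCmd contractibleE) (.seq (.cond (.var 11) contractCmd)
    (.cond (notE (.var 11)) branchCmd))))

/-- One step of the algorithm. -/
def stepCmd : Cmd := .seq (findCmd forcedE) (.seq (.cond (.var 11) markCmd)
  (.cond (notE (.var 11)) reduceCmd))

/-- The state holds a configuration. -/
def Sim (s : State) (x : Config n) : Prop := Rep s x.1 x.2.1 ∧ s.reg 5 = x.2.2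

/-- The input, the output and the registers of the main loops are unchanged. -/
abbrev StepFrame (n : ℕ) : State → State → Prop :=
  Frame n [5, 8, 9, 10, 11, 12, 13, 14, 15, 17] fun i => n + 1 ≤ i ∧ i ≠ n + n + 5

theorem run_branchCmd {c q : ℕ} (h : Rep s M S) (hd : ∀ u : Fin n, s.at (n + n + 2) u = resDeg M S u)
    (hc : s.reg 5 = c) (hq : s.reg 2 = q) (hq0 : 0 < q) (hQ : c ≤ s.reg 3) :
    Sim (branchCmd.run s) (match pick (Chosen M S (c % q)) with
      | some p => (M, insert p.1 S, c / q)
      | none => (M, S, c / q)) ∧ StepFrame n s (branchCmd.run s) := by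
  obtain ⟨f₁, h14, h5⟩ := run_divCmd hc hq hq0 hQ n
  set s₁ := divCmd.run s
  have r₁ := h.of_frame f₁ (by simp) (by simp)
  have hd₁ : ∀ u : Fin n, s₁.at (n + n + 2) u = resDeg M S u := fun u =>
    (f₁.row _ _ (by simp)).trans (hd u)
  obtain ⟨f₂, h₂⟩ := run_tabSum r₁.size (rowAt 4) rankE _ (val_rowAt 4)
    (fun u v => if resDeg M S u < resDeg M S v ∨ (resDeg M S u = resDeg M S v ∧ u < v) then 1 else 0)
    fun s' hf u v hu hv => val_rankE ((hf.reg 0 (by simp)).trans r₁.size)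
      (fun u => (hf.row _ _ (by omega)).trans (hd₁ u)) hu hv
  set s₂ := (tabSum (rowAt 4) rankE).run s₁
  have r₂ := r₁.of_frame f₂ (by simp) (by omega)
  have hrank : ∀ u : Fin n, s₂.at (n + n + 4) u = rank (resDeg M S) u := fun u => by
    rw [h₂, rank, Finset.card_filter]
  obtain ⟨f₃, h₃⟩ := run_findCmd r₂.size chosenE (Chosen M S (c % q)) fun s' hf u v hu hv => by
    have h0 := (hf.reg 0 (by simp)).trans r₂.size
    replace hu : (Exp.var 8).val s' = u := hu
    rw [chosenE, val_andE, val_eqE, val_fetch h0 (val_rowAt 2 s' h0) hu,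
      val_fetch h0 (val_rowAt 4 s' h0) hu, hf.row _ _ (by simp), hf.row _ _ (by simp), hrank,
      f₂.row _ _ (by omega), hd₁, Exp.val, hf.reg 14 (by simp), f₂.reg 14 (by simp), h14,
      Chosen, Nat.pos_iff_ne_zero]
  set s₃ := (findCmd chosenE).run s₂
  have r₃ := r₂.of_frame f₃ (by simp) (by simp)
  have f : StepFrame n s s₃ := ((f₁.mono (by simp) (by simp)).trans
    (f₂.mono (by simp) (by omega))).trans (f₃.mono (by simp) (by simp))
  have h5' : s₃.reg 5 = c / q := by rw [f₃.reg 5 (by simp), f₂.reg 5 (by simp), h5]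
  have e : branchCmd.run s = if s₃.reg 11 ≠ 0 then markCmd.run s₃ else s₃ := rfl
  rw [e]
  rcases h₃ with ⟨hp, h11⟩ | ⟨p, hp, h11, h12, -⟩
  · rw [hp, if_neg (by simp [h11])]
    exact ⟨⟨r₃, h5'⟩, f⟩
  · rw [hp, if_pos (by simp [h11])]
    obtain ⟨r₄, f₄⟩ := r₃.run_markCmd h12
    exact ⟨⟨r₄, (f₄.reg 5 (by simp)).trans h5'⟩, f.trans (f₄.mono (by simp) (by omega))⟩

theorem run_reduceCmd {c q : ℕ} (h : Rep s M S) (hc : s.reg 5 = c) (hq : s.reg 2 = q) (hq0 : 0 < q)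
    (hQ : c ≤ s.reg 3) :
    Sim (reduceCmd.run s) (match pick (Contractible M S) with
      | some p => (contract M p.1 p.2, S, c)
      | none => match pick (Chosen M S (c % q)) with
        | some p => (M, insert p.1 S, c / q)
        | none => (M, S, c / q)) ∧ StepFrame n s (reduceCmd.run s) := by
  obtain ⟨f₁, h₁⟩ := run_tabSum h.size (rowAt 2) degE _ (val_rowAt 2) _
    fun s' hf u v hu hv => (h.of_frame hf (by simp) (by omega)).val_degE hu hv
  set s₁ := (tabSum (rowAt 2) degE).run s
  have r₁ := h.of_frame f₁ (by simp) (by omega)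
  obtain ⟨f₂, h₂⟩ := run_tabSum r₁.size (rowAt 3) (matE (.var 8) (.var 9)) _ (val_rowAt 3) M
    fun s' hf u v hu hv => (r₁.of_frame hf (by simp) (by omega)).val_matE hu hv
  set s₂ := (tabSum (rowAt 3) (matE (.var 8) (.var 9))).run s₁
  have r₂ := r₁.of_frame f₂ (by simp) (by omega)
  have hd₂ : ∀ u : Fin n, s₂.at (n + n + 2) u = resDeg M S u := fun u => by
    rw [f₂.row _ _ (by omega), h₁, sum_ite_eq_resDeg]
  obtain ⟨f₃, h₃⟩ := run_findCmd r₂.size contractibleE (Contractible M S) fun s' hf u v hu hv =>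
    (r₂.of_frame hf (by simp) (by simp)).val_contractibleE
      (fun u => (hf.row _ _ (by simp)).trans (hd₂ u))
      (fun u => (hf.row _ _ (by simp)).trans (h₂ u)) hu hv
  set s₃ := (findCmd contractibleE).run s₂
  have r₃ := r₂.of_frame f₃ (by simp) (by simp)
  have f : StepFrame n s s₃ := ((f₁.mono (by simp) (by omega)).trans
    (f₂.mono (by simp) (by omega))).trans (f₃.mono (by simp) (by simp))
  have hc₃ : s₃.reg 5 = c := by
    rw [f₃.reg 5 (by simp), f₂.reg 5 (by simp), f₁.reg 5 (by simp), hc]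
  let s₄ := if s₃.reg 11 ≠ 0 then contractCmd.run s₃ else s₃
  have e : reduceCmd.run s = if (notE (.var 11)).val s₄ ≠ 0 then branchCmd.run s₄ else s₄ := rfl
  rw [e]
  rcases h₃ with ⟨hp, h11⟩ | ⟨p, hp, h11, h12, h13⟩
  · have e₄ : s₄ = s₃ := if_neg (by simp [h11])
    rw [hp, e₄, if_pos ((val_notE (a := .var 11)).2 h11)]
    obtain ⟨h₄, f₄⟩ := run_branchCmd r₃ (fun u => (f₃.row _ _ (by simp)).trans (hd₂ u)) hc₃
      ((f.reg 2 (by simp)).trans hq) hq0 (by rwa [f.reg 3 (by simp)])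
    exact ⟨h₄, f.trans f₄⟩
  · have e₄ : s₄ = contractCmd.run s₃ := if_pos (by simp [h11])
    obtain ⟨r₄, f₄⟩ := r₃.run_contractCmd h12 h13
    have h11' : (contractCmd.run s₃).reg 11 = 1 := (f₄.reg 11 (by simp)).trans h11
    rw [hp, e₄, if_neg (fun h' => by have := val_notE.1 h'; simp [Exp.val, h11'] at this)]
    exact ⟨⟨r₄, (f₄.reg 5 (by simp)).trans hc₃⟩, f.trans (f₄.mono (by simp) (by simp))⟩

theorem run_stepCmd {q : ℕ} {x : Config n} (h : Sim s x) (hq : s.reg 2 = q) (hq0 : 0 < q)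
    (hQ : x.2.2 ≤ s.reg 3) :
    Sim (stepCmd.run s) (algStep q x) ∧ StepFrame n s (stepCmd.run s) := by
  obtain ⟨M, S, c⟩ := x
  obtain ⟨h, hc⟩ := h
  obtain ⟨f₁, h₁⟩ := run_findCmd h.size forcedE (Forced M S) fun s' hf u v hu hv =>
    (h.of_frame hf (by simp) (by simp)).val_forcedE hu hv
  set s₁ := (findCmd forcedE).run s
  have r₁ := h.of_frame f₁ (by simp) (by simp)
  have f : StepFrame n s s₁ := f₁.mono (by simp) (by simp)
  have hc₁ : s₁.reg 5 = c := (f₁.reg 5 (by simp)).trans hc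
  let s₂ := if s₁.reg 11 ≠ 0 then markCmd.run s₁ else s₁
  have e : stepCmd.run s = if (notE (.var 11)).val s₂ ≠ 0 then reduceCmd.run s₂ else s₂ := rfl
  rw [e, algStep]
  rcases h₁ with ⟨hp, h11⟩ | ⟨p, hp, h11, h12, -⟩
  · have e₂ : s₂ = s₁ := if_neg (by simp [h11])
    rw [hp, e₂, if_pos ((val_notE (a := .var 11)).2 h11)]
    obtain ⟨h₂, f₂⟩ := run_reduceCmd r₁ hc₁ ((f.reg 2 (by simp)).trans hq) hq0
      (by rwa [f.reg 3 (by simp)])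
    exact ⟨h₂, f.trans f₂⟩
  · have e₂ : s₂ = markCmd.run s₁ := if_pos (by simp [h11])
    obtain ⟨r₂, f₂⟩ := r₁.run_markCmd h12
    -- Register `11` still records that a vertex was found, so the second conditional is skipped and
    -- only one rule is applied.
    have h11' : (markCmd.run s₁).reg 11 = 1 := (f₂.reg 11 (by simp)).trans h11
    rw [hp, e₂, if_neg (fun h' => by have := val_notE.1 h'; simp [Exp.val, h11'] at this)]
    exact ⟨⟨r₂, (f₂.reg 5 (by simp)).trans hc₁⟩, f.trans (f₂.mono (by simp) (by omega))⟩

end Rep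

end RAM

/-! ### Search over all choice codes and the complete program -/

namespace RAM

open MultMatrix

variable {n : ℕ} {s s' : State} {M : Fin n → Fin n → ℕ} {S : Finset (Fin n)}

/-- Keeps the code within the number of rounds available to the division loop. -/
theorem algStep_code_le (q : ℕ) (x : Config n) : (algStep q x).2.2 ≤ x.2.2 := by
  unfold algStep
  split
  · exact le_rfl
  · split
    · exact le_rfl
    · split <;> exact Nat.div_le_self _ _

theorem run_loop_stepCmd {q : ℕ} {x : Config n} (h : Sim s x) (hq : s.reg 2 = q) (hq0 : 0 < q)
    (hQ : x.2.2 ≤ s.reg 3) :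
    Sim ((Cmd.loop 7 0 stepCmd).run s) ((algStep q)^[n] x) ∧
      Frame n [5, 7, 8, 9, 10, 11, 12, 13, 14, 15, 17] (fun i => n + 1 ≤ i ∧ i ≠ n + n + 5) s
        ((Cmd.loop 7 0 stepCmd).run s) := by
  rw [Cmd.run_loop h.1.size]
  obtain ⟨h1, h2, -⟩ := iter_induction (m := n) (s := s)
    (f := fun i s => stepCmd.run (s.setReg 7 i))
    (fun i s' => Sim s' ((algStep q)^[i] x) ∧ Frame n [5, 7, 8, 9, 10, 11, 12, 13, 14, 15, 17]
      (fun i => n + 1 ≤ i ∧ i ≠ n + n + 5) s s' ∧ ((algStep q)^[i] x).2.2 ≤ s.reg 3)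
    ⟨h, .refl _ _ _ _, hQ⟩ (by
      rintro i - s' ⟨h1, h2, h3⟩
      have h4 := h2.setReg (r := 7) (by simp) i
      rw [Function.iterate_succ_apply']
      obtain ⟨h5, h6⟩ := run_stepCmd (s := s'.setReg 7 i) (x := (algStep q)^[i] x) (q := q)
        ⟨h1.1.of_frame (regs := [7]) (rows := fun _ => False)
          ((Frame.refl _ _ _ _).setReg (by simp) _) (by simp) (by simp), by simpa using h1.2⟩
        ((h4.reg 2 (by simp)).trans hq) hq0 (by rwa [h4.reg 3 (by simp)])
      exact ⟨h5, h4.trans (h6.mono (by simp) (by omega)), (algStep_code_le _ _).trans h3⟩)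
  exact ⟨h1, h2⟩

/-- Copy the input and set up the choice code in register `4`. -/
def initCmd : Cmd := .seq (tabRow (rowAt 1) (fetch (.var 0) (.var 8)))
  (.seq (tabBlock rowMat (fetch (.var 8) (.var 9))) (.assign 5 (.var 4)))

/-- The input is a multigraph `M` and a set `S`. -/
structure IsInput (s : State) (M : Fin n → Fin n → ℕ) (S : Finset (Fin n)) : Prop where
  size : s.reg 0 = n
  mat : ∀ u v : Fin n, s.at u v = M u v
  set : ∀ u : Fin n, s.at n u = if u ∈ S then 1 else 0

/-- The rows of the input and of the saved solution are not touched, so each code starts afresh and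
an earlier success is kept. -/
theorem IsInput.run_initCmd (h : IsInput s M S) :
    Sim (initCmd.run s) (M, S, s.reg 4) ∧
      Frame n [5, 8, 9] (fun i => n + 1 ≤ i ∧ i ≠ n + n + 5) s (initCmd.run s) := by
  obtain ⟨f₁, h₁⟩ := run_tabRow h.size (rowAt 1) (fetch (.var 0) (.var 8)) _ (val_rowAt 1)
    (fun u => if u ∈ S then 1 else 0) fun s' hf u hu => by
      have h0 := (hf.reg 0 (by simp)).trans h.size
      rw [val_fetch (i := .var 0) (j := .var 8) h0 h0 hu, hf.row _ _ (by omega), h.set]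
  set s₁ := (tabRow (rowAt 1) (fetch (.var 0) (.var 8))).run s
  have h0₁ := (f₁.reg 0 (by simp)).trans h.size
  obtain ⟨f₂, h₂⟩ := run_tabBlock h0₁ rowMat (fetch (.var 8) (.var 9)) _ val_rowMat M
    fun s' hf u v hu hv => by
      have h0 := (hf.reg 0 (by simp)).trans h0₁
      rw [val_fetch (i := .var 8) (j := .var 9) h0 hu hv, hf.row _ _ (by omega), f₁.row _ _ (by omega),
        h.mat]
  set s₂ := (tabBlock rowMat (fetch (.var 8) (.var 9))).run s₁
  have h4 : s₂.reg 4 = s.reg 4 := (f₂.reg 4 (by simp)).trans (f₁.reg 4 (by simp))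
  have e : initCmd.run s = s₂.setReg 5 (s.reg 4) := by
    rw [← h4]; rfl
  rw [e]
  refine ⟨⟨⟨?_, h₂, fun u => ?_⟩, by simp⟩, ?_⟩
  · simpa using (f₂.reg 0 (by simp)).trans h0₁
  · rw [State.at_setReg, f₂.row _ _ (by omega), h₁]
  · exact ((f₁.mono (by simp) (by omega)).trans (f₂.mono (by simp) (by omega))).setReg (by simp) _

/-- Run the algorithm with the choice code in register `4`; if it finds a solution, save it and
put `1` into register `6`. -/
def tryCmd : Cmd := .seq initCmd (.seq (.loop 7 0 stepCmd) (.seq (findCmd undoneE)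
  (.seq (sumCmd (setE (.var 9)))
    (.cond (andE (notE (.var 11)) (leE (.var 10) (.var 1)))
      (.seq (tabRow (rowAt 5) (setE (.var 8))) (.assign 6 (.lit 1)))))))

/-- The partial solution that the algorithm finds with the choice code `c`. -/
noncomputable def found (k : ℕ) (M : Fin n → Fin n → ℕ) (S : Finset (Fin n)) (c : ℕ) :
    Finset (Fin n) :=
  ((algStep (branching k))^[n] (M, S, c)).2.1

theorem IsInput.run_tryCmd {k : ℕ} (h : IsInput s M S) (hk : s.reg 1 = k)
    (hq : s.reg 2 = branching k) (hQ : s.reg 4 ≤ s.reg 3) :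
    Frame n [5, 6, 7, 8, 9, 10, 11, 12, 13, 14, 15, 17] (fun i => n + 1 ≤ i) s (tryCmd.run s) ∧
      ((Succeeds k n (s.reg 4) M S ∧ (tryCmd.run s).reg 6 = 1 ∧
        ∀ u : Fin n, (tryCmd.run s).at (n + n + 5) u = if u ∈ found k M S (s.reg 4) then 1 else 0) ∨
      (¬ Succeeds k n (s.reg 4) M S ∧ (tryCmd.run s).reg 6 = s.reg 6 ∧
        ∀ u : Fin n, (tryCmd.run s).at (n + n + 5) u = s.at (n + n + 5) u)) := by
  obtain ⟨h₁, f₁⟩ := h.run_initCmd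
  set s₁ := initCmd.run s
  obtain ⟨h₂, f₂⟩ := run_loop_stepCmd h₁ ((f₁.reg 2 (by simp)).trans hq) (branching_pos k)
    (by rwa [f₁.reg 3 (by simp)])
  set s₂ := (Cmd.loop 7 0 stepCmd).run s₁
  have r₂ := h₂.1
  set x := (algStep (branching k))^[n] (M, S, s.reg 4) with hx
  obtain ⟨f₃, h₃⟩ := run_findCmd r₂.size undoneE _ fun s' hf u v hu hv =>
    (r₂.of_frame hf (by simp) (by simp)).val_undoneE hu hv
  set s₃ := (findCmd undoneE).run s₂
  have r₃ := r₂.of_frame f₃ (by simp) (by simp)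
  have hdone : s₃.reg 11 = 0 ↔ IsDone x.1 x.2.1 := by
    rcases h₃ with ⟨hp, h11⟩ | ⟨p, hp, h11, -⟩
    · exact ⟨fun _ => (pick_spec _).2 hp, fun _ => h11⟩
    · exact ⟨fun h => by omega, fun h => absurd ((pick_spec _).1 p hp) (h p.1 p.2)⟩
  obtain ⟨f₄, h₄⟩ := run_sumCmd r₃.size (setE (.var 9)) _ fun s' hf v hv =>
    (r₃.of_frame hf (by simp) (by simp)).val_setE hv
  set s₄ := (sumCmd (setE (.var 9))).run s₃
  have r₄ := r₃.of_frame f₄ (by simp) (by simp)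
  have hcard : s₄.reg 10 = x.2.1.card := by
    rw [h₄]; simp
  have f : Frame n [5, 7, 8, 9, 10, 11, 12, 13, 14, 15, 17]
      (fun i => n + 1 ≤ i ∧ i ≠ n + n + 5) s s₄ :=
    (((f₁.mono (by simp) (by omega)).trans f₂).trans (f₃.mono (by simp) (by simp))).trans
      (f₄.mono (by simp) (by simp))
  have e : tryCmd.run s = if (andE (notE (.var 11)) (leE (.var 10) (.var 1))).val s₄ ≠ 0 then
      ((tabRow (rowAt 5) (setE (.var 8))).run s₄).setReg 6 1 else s₄ := rfl
  have hcond : (andE (notE (.var 11)) (leE (.var 10) (.var 1))).val s₄ ≠ 0 ↔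
      Succeeds k n (s.reg 4) M S := by
    rw [val_andE, val_notE, val_leE, Exp.val, Exp.val, Exp.val, f₄.reg 11 (by simp), hdone, hcard,
      f.reg 1 (by simp), hk]
    rfl
  rw [e]
  by_cases hs : Succeeds k n (s.reg 4) M S
  · rw [if_pos (hcond.2 hs)]
    obtain ⟨f₅, h₅⟩ := run_tabRow r₄.size (rowAt 5) (setE (.var 8)) _ (val_rowAt 5) _
      fun s' hf u hu => (r₄.of_frame hf (by simp) (by omega)).val_setE hu
    exact ⟨((f.mono (by simp) (by omega)).trans (f₅.mono (by simp) (by omega))).setReg (by simp) _,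
      Or.inl ⟨hs, by simp, h₅⟩⟩
  · rw [if_neg (fun h => hs (hcond.1 h))]
    exact ⟨f.mono (by simp) (by omega), Or.inr ⟨hs, f.reg 6 (by simp), fun u => f.row _ _ (by simp)⟩⟩

/-- Try all choice codes and write the solution found. -/
def searchCmd : Cmd := .seq (.assign 6 (.lit 0)) (.seq (.loop 4 3 tryCmd)
  (tabRow (.lit 0) (fetch (rowAt 5) (.var 8))))

theorem IsInput.run_searchCmd {k : ℕ} (h : IsInput s M S) (hk : s.reg 1 = k)
    (hq : s.reg 2 = branching k) :
    ((searchCmd.run s).reg 6 = 0 ∧ ∀ c < s.reg 3, ¬ Succeeds k n c M S) ∨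
    ((searchCmd.run s).reg 6 = 1 ∧ ∃ c < s.reg 3, Succeeds k n c M S ∧
      ∀ u : Fin n, (searchCmd.run s).at 0 u = if u ∈ found k M S c then 1 else 0) := by
  obtain ⟨f₁, h₁⟩ := iter_induction (m := s.reg 3) (s := s.setReg 6 0)
    (f := fun c s => tryCmd.run (s.setReg 4 c))
    (fun c s' => Frame n [4, 5, 6, 7, 8, 9, 10, 11, 12, 13, 14, 15, 17] (fun i => n + 1 ≤ i) s s' ∧
      ((s'.reg 6 = 0 ∧ ∀ c' < c, ¬ Succeeds k n c' M S) ∨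
      (s'.reg 6 = 1 ∧ ∃ c' < c, Succeeds k n c' M S ∧
        ∀ u : Fin n, s'.at (n + n + 5) u = if u ∈ found k M S c' then 1 else 0)))
    ⟨(Frame.refl _ _ _ _).setReg (by simp) _, Or.inl (by simp)⟩ (by
      rintro c hc s' ⟨f, h'⟩
      have f' := f.setReg (r := 4) (by simp) c
      obtain ⟨f₂, h₂⟩ := IsInput.run_tryCmd (s := s'.setReg 4 c) (M := M) (S := S)
        ⟨(f'.reg 0 (by simp)).trans h.size, fun u v => (f'.row _ _ (by omega)).trans (h.mat u v),
          fun u => (f'.row _ _ (by omega)).trans (h.set u)⟩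
        ((f'.reg 1 (by simp)).trans hk) ((f'.reg 2 (by simp)).trans hq)
        (by rw [f'.reg 3 (by simp)]; simpa using hc.le)
      refine ⟨f'.trans (f₂.mono (by simp) (by simp)), ?_⟩
      have h4 : (s'.setReg 4 c).reg 4 = c := by simp
      have h6 : (s'.setReg 4 c).reg 6 = s'.reg 6 := by simp
      rw [h4, h6] at h₂
      rcases h₂ with ⟨hs, h1, hr⟩ | ⟨hs, h1, hr⟩
      · exact Or.inr ⟨h1, c, by omega, hs, hr⟩
      · rw [h1]
        rcases h' with ⟨h7, h8⟩ | ⟨h7, c', hc', h8, h9⟩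
        · refine Or.inl ⟨h7, fun c' hc' => ?_⟩
          rcases Nat.lt_succ_iff_lt_or_eq.1 hc' with h10 | rfl
          · exact h8 c' h10
          · exact hs
        · exact Or.inr ⟨h7, c', by omega, h8, fun u => by rw [hr]; exact h9 u⟩)
  set s₁ := iter (fun c s => tryCmd.run (s.setReg 4 c)) (s.reg 3) (s.setReg 6 0)
  have h0 := (f₁.reg 0 (by simp)).trans h.size
  obtain ⟨f₂, h₂⟩ := run_tabRow h0 (.lit 0) (fetch (rowAt 5) (.var 8)) 0 (fun _ _ => rfl)
    (fun u => s₁.at (n + n + 5) u) fun s' hf u hu => by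
      have h0' := (hf.reg 0 (by simp)).trans h0
      rw [val_fetch (j := .var 8) h0' (val_rowAt 5 s' h0') hu, hf.row _ _ (by omega)]
  have e : searchCmd.run s = (tabRow (.lit 0) (fetch (rowAt 5) (.var 8))).run s₁ := by
    have : (Cmd.loop 4 3 tryCmd).run (s.setReg 6 0) = s₁ := Cmd.run_loop (by simp)
    rw [← this]
    rfl
  rw [e, f₂.reg 6 (by simp)]
  refine h₁.imp_right fun h => ⟨h.1, ?_⟩
  obtain ⟨c, hc, hs, hr⟩ := h.2
  exact ⟨c, hc, hs, fun u => (h₂ u).trans (hr u)⟩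

/-- Replace the parameter `k` by `min k n`. -/
def minCmd : Cmd := .assign 1 (.sub (.var 1) (.sub (.var 1) (.var 0)))

/-- Compute the number of choices for a branching step. -/
def branchingCmd : Cmd := .assign 2 (.add (.mul (.mul (.lit 5) 1) 1) (.lit 1))

/-- Compute the number of choice codes. -/
def powCmd : Cmd := .seq (.assign 3 (.lit 1)) (.loop 4 1 (.assign 3 (.mul (.var 3) 2)))

/-- The program for FT-FVS-Ext. -/
def ftfvsProg : Prog := .seq (minCmd.compile 18) (.seq (branchingCmd.compile 18)
  (.seq (powCmd.compile 18) (.seq (searchCmd.compile 18) ((Cmd.assign 0 (.var 6)).compile 18))))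

theorem run_powCmd {k q : ℕ} (hk : s.reg 1 = k) (hq : s.reg 2 = q) :
    (powCmd.run s).reg 3 = q ^ k ∧ (∀ r < 3, (powCmd.run s).reg r = s.reg r) ∧
      (powCmd.run s).mem = s.mem := by
  have e : powCmd.run s = (Cmd.loop 4 1 (.assign 3 (.mul (.var 3) 2))).run (s.setReg 3 1) := rfl
  rw [e, Cmd.run_loop (m := k) (by simpa using hk)]
  refine iter_induction (fun i (s' : State) => s'.reg 3 = q ^ i ∧ (∀ r < 3, s'.reg r = s.reg r) ∧
    s'.mem = s.mem) ⟨by simp, fun r hr => ?_, rfl⟩ ?_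
  · rw [State.reg_setReg, if_neg (by omega)]
  · rintro i - s' ⟨h1, h2, h3⟩
    refine ⟨by simp [Cmd.run, Exp.val, h1, h2 2 (by norm_num), hq, pow_succ], fun r hr => ?_, h3⟩
    simp [Cmd.run, show r ≠ 3 by omega, show r ≠ 4 by omega, h2 r hr]

/-- The program is compiled in phases because a register may bound loops only while it is constant:
each of the first three phases computes a register that is constant in the next. The last phase
overwrites the register of `n` with the answer. -/
theorem exec_ftfvsProg : ∃ f, PolyBounded f ∧ ∀ {n : ℕ} (s : State) (M : Fin n → Fin n → ℕ)
    (S : Finset (Fin n)), IsInput s M S → ∀ k, min (s.reg 1) n = k →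
    ∃ T s', Exec ftfvsProg s T s' ∧ T ≤ f (n + k + branching k + branching k ^ k) ∧
      ((s'.reg 0 = 0 ∧ ∀ c < branching k ^ k, ¬ Succeeds k n c M S) ∨
      (s'.reg 0 = 1 ∧ ∃ c < branching k ^ k, Succeeds k n c M S ∧
        ∀ u : Fin n, s'.at 0 u = if u ∈ found k M S c then 1 else 0)) := by
  refine ⟨_, minCmd.polyBounded_cost.add (branchingCmd.polyBounded_cost.add
    (powCmd.polyBounded_cost.add (searchCmd.polyBounded_cost.add
    (Cmd.assign 0 (.var 6)).polyBounded_cost))), fun {n} s M S h k hk => ?_⟩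
  set N := n + k + branching k + branching k ^ k with hN
  set s₁ := minCmd.run s with hs₁
  set s₂ := branchingCmd.run s₁ with hs₂
  set s₃ := powCmd.run s₂ with hs₃
  have h1 : s₁.reg 1 = k := by
    simp [hs₁, minCmd, Cmd.run, Exp.val, h.size]
    omega
  have h2 : s₂.reg 2 = branching k := by
    simp [hs₂, branchingCmd, Cmd.run, Exp.val, h1, branching, mul_assoc]
  have h21 : s₂.reg 1 = k := by simpa [hs₂, branchingCmd, Cmd.run] using h1
  have h10 : s₁.reg 0 = n := by simpa [hs₁, minCmd, Cmd.run] using h.size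
  have h20 : s₂.reg 0 = n := by simpa [hs₂, branchingCmd, Cmd.run] using h10
  obtain ⟨h33, h3r, h3m⟩ : s₃.reg 3 = branching k ^ k ∧ (∀ r < 3, s₃.reg r = s₂.reg r) ∧
      s₃.mem = s₂.mem := run_powCmd h21 h2
  have hi : IsInput s₃ M S := by
    have hm : s₃.mem = s.mem := h3m
    exact ⟨(h3r 0 (by norm_num)).trans h20, fun u v => (congrFun hm _).trans (h.mat u v),
      fun u => (congrFun hm _).trans (h.set u)⟩
  obtain ⟨T₁, t₁, e₁, hT₁, a₁, -⟩ := minCmd.exec_compile (v := 18) (κ := 0) (N := N) (by norm_num)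
    (by decide) 18 le_rfl s s (.refl _ _) (by simp)
  obtain ⟨T₂, t₂, e₂, hT₂, a₂, -⟩ := branchingCmd.exec_compile (v := 18) (κ := 2) (N := N)
    (by norm_num) (by decide) 18 le_rfl _ t₁ a₁ (by
      intro r hr
      change s₁.reg r ≤ N
      interval_cases r <;> omega)
  obtain ⟨T₃, t₃, e₃, hT₃, a₃, -⟩ := powCmd.exec_compile (v := 18) (κ := 3) (N := N)
    (by norm_num) (by decide) 18 le_rfl _ t₂ a₂ (by
      intro r hr
      change s₂.reg r ≤ N
      interval_cases r <;> omega)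
  obtain ⟨T₄, t₄, e₄, hT₄, a₄, -⟩ := searchCmd.exec_compile (v := 18) (κ := 4) (N := N)
    (by norm_num) (by decide) 18 le_rfl _ t₃ a₃ (by
      intro r hr
      change s₃.reg r ≤ N
      have := h3r r
      interval_cases r <;> omega)
  obtain ⟨T₅, t₅, e₅, hT₅, a₅, -⟩ := (Cmd.assign 0 (.var 6)).exec_compile (v := 18) (κ := 0)
    (N := N) (by norm_num) (by decide) 18 le_rfl _ t₄ a₄ (by simp)
  refine ⟨_, t₅, .seq e₁ (.seq e₂ (.seq e₃ (.seq e₄ e₅))), by omega, ?_⟩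
  have h0 : t₅.reg 0 = (searchCmd.run s₃).reg 6 := by
    rw [a₅.1 0 (by norm_num)]
    simp [Cmd.run, Exp.val, hs₁, hs₂, hs₃]
  have hm : ∀ u : Fin n, t₅.at 0 u = (searchCmd.run s₃).at 0 u := fun u => congrFun a₅.2 _
  simp only [h0, hm]
  have := hi.run_searchCmd ((h3r 1 (by norm_num)).trans h21) ((h3r 2 (by norm_num)).trans h2)
  rwa [h33] at this

end RAM

open MultMatrix in
theorem isInput_extInput {n : ℕ} {β : Type*} (G : Graph (Fin n) β) (S : Finset (Fin n)) (k : ℕ) :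
    RAM.IsInput (extInput G S k) G.multiplicity S where
  size := rfl
  mat u v := by
    have h1 : ¬ ∃ w ∈ S, (u : ℕ) * n + v = n * n + (w : ℕ) := by
      rintro ⟨w, -, h⟩
      have := (RAM.address_inj.1 h).1
      omega
    have h2 : (u : ℕ) * n + v < n * n := by
      have := Nat.mul_le_mul_right n (Nat.succ_le_of_lt u.2)
      rw [Nat.succ_mul] at this
      omega
    simp only [RAM.State.at, extInput, ftfvsInput, if_neg h1, dif_pos h2]
    have hn := u.pos
    congr 1 <;> ext
    · simp [Fin.coe_divNat, mul_comm _ n, Nat.mul_add_div hn]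
    · simp [Fin.coe_modNat, mul_comm _ n, Nat.mod_eq_of_lt v.2]
  set u := by
    have h1 : (∃ w ∈ S, n * n + (u : ℕ) = n * n + (w : ℕ)) ↔ u ∈ S := by
      simp [Fin.val_inj]
    simp only [RAM.State.at, extInput, ftfvsInput, h1]
    congr 1
    simp

theorem extInput_empty {n : ℕ} {β : Type*} (G : Graph (Fin n) β) (k : ℕ) :
    extInput G ∅ k = ftfvsInput G k := by
  simp [extInput]

/-- For `k' ≥ 2` one has $5k'^2+1\le k'^5$. The factor 6 covers `k' = 1`, where the base is 6; for
`k' = 0` the power is one, and so is `k ^ (5 * k)` at `k = 0`. -/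
theorem branching_pow_le {k k' : ℕ} (h : k' ≤ k) :
    MultMatrix.branching k' ^ k' ≤ 6 * k ^ (5 * k) := by
  have hpos : 0 < k ^ (5 * k) := by
    rcases Nat.eq_zero_or_pos k with rfl | hk
    · simp
    · positivity
  obtain rfl | rfl | h2 : k' = 0 ∨ k' = 1 ∨ 2 ≤ k' := by omega
  · simp only [pow_zero]
    omega
  · simp only [MultMatrix.branching, pow_one]
    omega
  · have h3 : MultMatrix.branching k' ≤ k' ^ 5 := by
      have h4 : 2 ^ 3 ≤ k' ^ 3 := Nat.pow_le_pow_left h2 3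
      have h5 : 2 ^ 2 ≤ k' ^ 2 := Nat.pow_le_pow_left h2 2
      have h6 := Nat.mul_le_mul_right (k' ^ 2) h4
      rw [← pow_add, show 3 + 2 = 5 from rfl] at h6
      rw [MultMatrix.branching, ← sq]
      omega
    calc _ ≤ (k' ^ 5) ^ k' := Nat.pow_le_pow_left h3 _
      _ = k' ^ (5 * k') := (pow_mul _ _ _).symm
      _ ≤ k ^ (5 * k') := Nat.pow_le_pow_left h _
      _ ≤ k ^ (5 * k) := Nat.pow_le_pow_right (by omega) (by omega)
      _ ≤ _ := by omega

/-- A polynomial in the number of vertices and the number of choice codes is a bound of the form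
`k ^ O(k) * n ^ O(1)`. -/
theorem RAM.PolyBounded.exists_fpt_bound {f : ℕ → ℕ} (hf : RAM.PolyBounded f) :
    ∃ c, ∀ n k k' : ℕ, k' ≤ k → k' ≤ n →
      f (n + k' + MultMatrix.branching k' + MultMatrix.branching k' ^ k') ≤
        c * k ^ (c * k) * (n + 1) ^ c := by
  obtain ⟨a, d, hf⟩ := hf
  -- The first summand absorbs the coefficient, the second the exponents `5 * d` and `2 * d`.
  refine ⟨a * 42 ^ d + 5 * d, fun n k k' hk hn => (hf _).trans ?_⟩
  set c := a * 42 ^ d + 5 * d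
  have hpos : 0 < k ^ (5 * k) := by
    rcases Nat.eq_zero_or_pos k with rfl | hk
    · simp
    · positivity
  have h1 : n + k' + MultMatrix.branching k' + MultMatrix.branching k' ^ k' + 1 ≤
      42 * (k ^ (5 * k) * (n + 1) ^ 2) := by
    have h2 := branching_pow_le hk
    have h3 : MultMatrix.branching k' ≤ 5 * n ^ 2 + 1 := by
      have := Nat.mul_le_mul hn hn
      rw [MultMatrix.branching, sq]
      omega
    have h4 : (n + 1) ^ 2 = n ^ 2 + 2 * n + 1 := by ring
    have h5 := Nat.le_mul_of_pos_left ((n + 1) ^ 2) hpos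
    have h6 := Nat.le_mul_of_pos_right (k ^ (5 * k)) (show 0 < (n + 1) ^ 2 by positivity)
    omega
  have h7 : k ^ (5 * k * d) ≤ k ^ (c * k) := by
    rcases Nat.eq_zero_or_pos k with rfl | hk
    · simp
    · refine Nat.pow_le_pow_right hk ?_
      rw [mul_right_comm]
      exact Nat.mul_le_mul_right _ (Nat.le_add_left _ _)
  have h8 : (n + 1) ^ (2 * d) ≤ (n + 1) ^ c := Nat.pow_le_pow_right (by omega) (by omega)
  calc _ ≤ a * (42 * (k ^ (5 * k) * (n + 1) ^ 2)) ^ d := by gcongr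
    _ = a * 42 ^ d * k ^ (5 * k * d) * (n + 1) ^ (2 * d) := by
      rw [mul_pow, mul_pow, ← pow_mul, ← pow_mul]; ring
    _ ≤ c * k ^ (c * k) * (n + 1) ^ c := by
      gcongr
      exact Nat.le_add_right _ _

open MultMatrix in
theorem ftfvsProg_solves : ∃ c, ∀ (n : ℕ) (β : Type*) (G : Graph (Fin n) β),
    G.vertexSet = Set.univ → G.edgeSet.Finite → G.Loopless → ∀ (S : Finset (Fin n)) (k : ℕ),
      RAM.SolvesWithin RAM.ftfvsProg (extInput G S k) (c * k ^ (c * k) * (n + 1) ^ c)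
        (IsExtSolution G S k) := by
  obtain ⟨f, hf, hprog⟩ := RAM.exec_ftfvsProg
  obtain ⟨c, hc⟩ := hf.exists_fpt_bound
  refine ⟨c, fun n β G hV hE hL S k => ?_⟩
  obtain ⟨T, s', he, hT, hs⟩ := hprog _ _ _ (isInput_extInput G S k) (min k n) rfl
  refine ⟨T, s', he, hT.trans (hc n k _ (min_le_left _ _) (min_le_right _ _)), ?_⟩
  have hM := G.isLoopless_multiplicity
  have hiff := Graph.isFaultTolerantFVS_one_iff hV hE
  rcases hs with ⟨h0, hno⟩ | ⟨h0, code, -, hsucc, hout⟩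
  · refine Or.inr ⟨h0, fun X ⟨hX, hXk, hSX⟩ => ?_⟩
    rw [hiff] at hX
    -- Running with `min k n` loses no solution, since no vertex set has more than `n` elements.
    have hXn : X.card ≤ n := by simpa using X.card_le_univ
    have hpot : potential G.multiplicity S ≤ n := by
      simpa [potential] using Finset.card_le_univ
        (Finset.univ.filter fun u => u ∉ S ∧ ∃ v, G.multiplicity u v ≠ 0)
    obtain ⟨code, hcode, hsucc⟩ := exists_code n hM hSX (le_min hXk hXn) hX hpot
    exact hno code (hcode.trans_le (Nat.pow_le_pow_right (branching_pos _) (Nat.sub_le _ _))) hsucc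
  · refine Or.inl ⟨h0, ?_⟩
    have hX : s'.output n = RAM.found (min k n) G.multiplicity S code := by
      ext v
      have h := hout v
      simp only [RAM.State.at, zero_mul, zero_add] at h
      simp [RAM.State.output, h]
    rw [hX]
    -- The final partial solution hits twice in the final graph by `IsDone.hitsTwice`, and
    -- refinement carries this back to the input graph.
    have href := refines_iterate (branching (min k n)) (x := (G.multiplicity, S, code)) hM n
    exact ⟨(hiff _).2 (href.2.2 _ Finset.Subset.rfl (hsucc.1.hitsTwice href.1)),
      hsucc.2.trans (min_le_left _ _), href.2.1⟩

theorem theorem4 :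
    (∃ (P : RAM.Prog) (c : ℕ), ∀ (n : ℕ) (β : Type*) (G : Graph (Fin n) β),
      G.vertexSet = Set.univ → G.edgeSet.Finite → G.Loopless →
      ∀ (S : Finset (Fin n)) (k : ℕ),
        RAM.SolvesWithin P (extInput G S k) (c * k ^ (c * k) * (n + 1) ^ c)
          (IsExtSolution G S k)) ∧
    (∃ (P : RAM.Prog) (c : ℕ), ∀ (n : ℕ) (β : Type*) (G : Graph (Fin n) β),
      G.vertexSet = Set.univ → G.edgeSet.Finite → G.Loopless →
      ∀ k : ℕ,
        RAM.SolvesWithin P (ftfvsInput G k) (c * k ^ (c * k) * (n + 1) ^ c)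
          (IsFTFVSSolution G k)) := by
  refine ⟨⟨RAM.ftfvsProg, ftfvsProg_solves⟩, RAM.ftfvsProg, ?_⟩
  obtain ⟨c, hc⟩ := ftfvsProg_solves
  refine ⟨c, fun n β G hV hE hL k => ?_⟩
  -- With `S = ∅` the characteristic vector is zero, so both problems have the same input state and
  -- the same program serves both.
  have h := hc n β G hV hE hL ∅ k
  rw [extInput_empty] at h
  have hsol : IsExtSolution G ∅ k = IsFTFVSSolution G k := by
    funext X
    simp [IsExtSolution, IsFTFVSSolution]
  rwa [hsol] at h
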